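/- Consider finite graphs $G=\langle V,s_1,s_2,\mathrm{null},\mathrm{root}\rangle$, where $V$ is a finite set, $\mathrm{null}\neq\mathrm{root}$ are elements of $V$, and $s_1,s_2\subseteq V\times V$ are edge relations such that $\langle \mathrm{null},x\rangle\in s_i$ iff $x=\mathrm{null}$, for $i=1,2$. A homomorphism from $G$ to $G'$ is a map $h:V\to V'$ such that $\langle x,y\rangle\in s_i$ implies $\langle h(x),h(y)\rangle\in s_i'$ for $i=1,2$, $h(x)=\mathrm{root}'$ iff $x=\mathrm{root}$, and $h(x)=\mathrm{null}'$ iff $x=\mathrm{null}$; we write $G\to G'$ if one exists. A corresponder graph is a graph isomorphic, for some integers $n,k\ge 2$, $0=u_0<u_1<\dots<u_{k-1}<n$ and $0=l_0<l_1<\dots<l_{k-1}<n$, to the graph with the (pairwise distinct) nodes $\mathrm{null},\mathrm{root},C_0,\dots,C_{2k-1},U_0,\dots,U_{2n-1},L_0,\dots,L_{2n-1}$ in which $s_1$ and $s_2$ are the following total functions: - $s_1(\mathrm{null})=\mathrm{null}$, $s_1(\mathrm{root})=C_0$, $s_1(C_i)=C_{i+1}$ for $i<2k-1$, $s_1(U_i)=U_{i+1}$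 and $s_1(L_i)=L_{i+1}$ for $i<2n-1$, and $s_1(C_{2k-1})=s_1(U_{2n-1})=s_1(L_{2n-1})=\mathrm{null}$; - $s_2(\mathrm{null})=s_2(\mathrm{root})=\mathrm{null}$; $s_2(C_{2i})=U_{2u_i}$ and $s_2(C_{2i+1})=L_{2l_i+1}$ for $0\le i<k$; $s_2(U_{2i})=L_{2i}$ and $s_2(L_{2i+1})=U_{2i+1}$ for $0\le i<n$; $s_2(U_{2i+1})=\mathrm{root}$ if $i\in\{l_0,\dots,l_{k-1}\}$ and $s_2(U_{2i+1})=\mathrm{null}$ for the other $0\le i<n$; $s_2(L_{2i})=\mathrm{root}$ if $i\in\{u_0,\dots,u_{k-1}\}$ and $s_2(L_{2i})=\mathrm{null}$ for the other $0\le i<n$. **Proposition.** Satisfiability of graphs over the class of corresponder graphs is undecidable: no algorithm decides, given a finite graph $G$ (presented by its number of nodes and its lists of edges), whether there is a corresponder graph $G_0$ with $G_0\to G$. Moreover, the Post correspondence problem reduces to it: there is a computable function that assigns to every PCP instance, that is, to every finite sequence $\langle v_0,w_0\rangle,\dots,\langle v_{m-1},w_{m-1}\rangle$ of pairs of nonempty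 words, a finite graph $G$ such that some corresponder graph $G_0$ satisfies $G_0\to G$ if and only if the instance has a solution, that is, a nonempty sequence of indices $t_0,\dots,t_{k-1}$ with $v_{t_0}v_{t_1}\cdots v_{t_{k-1}}=w_{t_0}w_{t_1}\cdots w_{t_{k-1}}$. -/

import Mathlib

namespace RegGraph

/-- A graph `⟨V, s₁, s₂, null, root⟩`: a finite set of nodes with two arbitrary edge relations and
two distinct constants, such that the only edges leaving `null` are the two loops at `null`. -/
structure Graph where
  V : Type
  finite : Finite V
  s₁ : V → V → Prop
  s₂ : V → V → Prop
  null : V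
  root : V
  root_ne_null : root ≠ null
  null_s₁ : ∀ x, s₁ null x ↔ x = null
  null_s₂ : ∀ x, s₂ null x ↔ x = null

/-- `h` is a homomorphism from `G` to `G'`. -/
structure IsHom (G G' : Graph) (h : G.V → G'.V) : Prop where
  map_s₁ : ∀ x y, G.s₁ x y → G'.s₁ (h x) (h y)
  map_s₂ : ∀ x y, G.s₂ x y → G'.s₂ (h x) (h y)
  root_iff : ∀ x, h x = G'.root ↔ x = G.root
  null_iff : ∀ x, h x = G'.null ↔ x = G.null

/-- `G → G'`: there is a homomorphism from `G` to `G'`. -/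
def MapsTo (G G' : Graph) : Prop := ∃ h : G.V → G'.V, IsHom G G' h

/-- `G` and `G'` are isomorphic as relational structures. -/
def Isomorphic (G G' : Graph) : Prop :=
  ∃ e : G.V ≃ G'.V,
    (∀ x y, G.s₁ x y ↔ G'.s₁ (e x) (e y)) ∧ (∀ x y, G.s₂ x y ↔ G'.s₂ (e x) (e y)) ∧
      e G.null = G'.null ∧ e G.root = G'.root

/-- `G'` is satisfiable over the class `C` of graphs. -/
def SatisfiableOver (C : Graph → Prop) (G' : Graph) : Prop := ∃ G, C G ∧ MapsTo G G'

/-- The parameters `n, k ≥ 2`, `0 = u₀ < u₁ < ⋯ < u_{k-1} < n` and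
`0 = l₀ < l₁ < ⋯ < l_{k-1} < n` of a corresponder graph. -/
structure CorrParams where
  n : ℕ
  k : ℕ
  two_le_n : 2 ≤ n
  two_le_k : 2 ≤ k
  u : Fin k → Fin n
  l : Fin k → Fin n
  u_zero : (u ⟨0, by omega⟩ : ℕ) = 0
  l_zero : (l ⟨0, by omega⟩ : ℕ) = 0
  u_strictMono : StrictMono u
  l_strictMono : StrictMono l

/-- The nodes `null`, `root`, `C₀, …, C_{2k-1}`, `U₀, …, U_{2n-1}`, `L₀, …, L_{2n-1}`. -/
inductive CorrNode (n k : ℕ) : Type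
  | null : CorrNode n k
  | root : CorrNode n k
  | C (i : Fin (2 * k)) : CorrNode n k
  | U (i : Fin (2 * n)) : CorrNode n k
  | L (i : Fin (2 * n)) : CorrNode n k

theorem CorrNode.finite (n k : ℕ) : Finite (CorrNode n k) := by
  let f : Option (Option (Fin (2 * k) ⊕ (Fin (2 * n) ⊕ Fin (2 * n)))) → CorrNode n k := fun x =>
    match x with
    | none => .null
    | some none => .root
    | some (some (.inl i)) => .C i
    | some (some (.inr (.inl i))) => .U i
    | some (some (.inr (.inr i))) => .L i
  refine Finite.of_surjective f ?_
  rintro (_ | _ | i | i | i)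
  · exact ⟨none, rfl⟩
  · exact ⟨some none, rfl⟩
  · exact ⟨some (some (.inl i)), rfl⟩
  · exact ⟨some (some (.inr (.inl i))), rfl⟩
  · exact ⟨some (some (.inr (.inr i))), rfl⟩

/-- The `s₁`-edges of a corresponder graph (including the loop at `null`). -/
inductive CorrS₁ (p : CorrParams) : CorrNode p.n p.k → CorrNode p.n p.k → Prop
  | null : CorrS₁ p .null .null
  | root (i : Fin (2 * p.k)) (hi : (i : ℕ) = 0) : CorrS₁ p .root (.C i)
  | C_next (i j : Fin (2 * p.k)) (hj : (j : ℕ) = i + 1) : CorrS₁ p (.C i) (.C j)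
  | C_last (i : Fin (2 * p.k)) (hi : (i : ℕ) + 1 = 2 * p.k) : CorrS₁ p (.C i) .null
  | U_next (i j : Fin (2 * p.n)) (hj : (j : ℕ) = i + 1) : CorrS₁ p (.U i) (.U j)
  | U_last (i : Fin (2 * p.n)) (hi : (i : ℕ) + 1 = 2 * p.n) : CorrS₁ p (.U i) .null
  | L_next (i j : Fin (2 * p.n)) (hj : (j : ℕ) = i + 1) : CorrS₁ p (.L i) (.L j)
  | L_last (i : Fin (2 * p.n)) (hi : (i : ℕ) + 1 = 2 * p.n) : CorrS₁ p (.L i) .null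

/-- The `s₂`-edges of a corresponder graph (including the loop at `null`). -/
inductive CorrS₂ (p : CorrParams) : CorrNode p.n p.k → CorrNode p.n p.k → Prop
  | null : CorrS₂ p .null .null
  | root : CorrS₂ p .root .null
  | C_even (i : Fin p.k) (c : Fin (2 * p.k)) (x : Fin (2 * p.n))
      (hc : (c : ℕ) = 2 * i) (hx : (x : ℕ) = 2 * p.u i) : CorrS₂ p (.C c) (.U x)
  | C_odd (i : Fin p.k) (c : Fin (2 * p.k)) (x : Fin (2 * p.n))
      (hc : (c : ℕ) = 2 * i + 1) (hx : (x : ℕ) = 2 * p.l i + 1) : CorrS₂ p (.C c) (.L x)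
  | U_even (i : Fin p.n) (x : Fin (2 * p.n)) (hx : (x : ℕ) = 2 * i) : CorrS₂ p (.U x) (.L x)
  | L_odd (i : Fin p.n) (x : Fin (2 * p.n)) (hx : (x : ℕ) = 2 * i + 1) : CorrS₂ p (.L x) (.U x)
  | U_odd_null (i : Fin p.n) (x : Fin (2 * p.n)) (hx : (x : ℕ) = 2 * i + 1)
      (hi : ∀ j, p.l j ≠ i) : CorrS₂ p (.U x) .null
  | U_odd_root (j : Fin p.k) (x : Fin (2 * p.n)) (hx : (x : ℕ) = 2 * p.l j + 1) :
      CorrS₂ p (.U x) .root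
  | L_even_null (i : Fin p.n) (x : Fin (2 * p.n)) (hx : (x : ℕ) = 2 * i)
      (hi : ∀ j, p.u j ≠ i) : CorrS₂ p (.L x) .null
  | L_even_root (j : Fin p.k) (x : Fin (2 * p.n)) (hx : (x : ℕ) = 2 * p.u j) :
      CorrS₂ p (.L x) .root

/-- The graph `CG(n, k, u₁, …, u_{k-1}, l₁, …, l_{k-1})`. -/
def CG (p : CorrParams) : Graph where
  V := CorrNode p.n p.k
  finite := CorrNode.finite p.n p.k
  s₁ := CorrS₁ p
  s₂ := CorrS₂ p
  null := .null
  root := .root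
  root_ne_null := by simp
  null_s₁ := fun _ => ⟨fun h => by cases h; rfl, fun h => by rw [h]; exact CorrS₁.null⟩
  null_s₂ := fun _ => ⟨fun h => by cases h; rfl, fun h => by rw [h]; exact CorrS₂.null⟩

/-- A corresponder graph is a graph isomorphic to some `CG(n, k, u, l)`. -/
def IsCorresponder (G : Graph) : Prop := ∃ p : CorrParams, Isomorphic G (CG p)

/-- The finite data `(N, E₁, E₂)` by which a graph is given to an algorithm: the nodes are
`0, …, N + 1`, with `null = 0` and `root = 1`, and `E₁`, `E₂` list the edges leaving nodes other
than `null`. -/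
abbrev GraphCode : Type := ℕ × List (ℕ × ℕ) × List (ℕ × ℕ)

/-- The graph with code `(N, E₁, E₂)`. (Listed pairs that mention a number above `N + 1`, or that
start at `null`, have no effect.) -/
def GraphCode.toGraph (c : GraphCode) : Graph where
  V := Fin (c.1 + 2)
  finite := inferInstance
  s₁ := fun x y => (x = 0 ∧ y = 0) ∨ (x ≠ 0 ∧ ((x : ℕ), (y : ℕ)) ∈ c.2.1)
  s₂ := fun x y => (x = 0 ∧ y = 0) ∨ (x ≠ 0 ∧ ((x : ℕ), (y : ℕ)) ∈ c.2.2)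
  null := 0
  root := 1
  root_ne_null := by simp
  null_s₁ := by simp
  null_s₂ := by simp

/-- Every graph has a code, up to isomorphism. -/
theorem exists_code (G : Graph) : ∃ c : GraphCode, Isomorphic G (GraphCode.toGraph c) := by
  classical
  have : Finite G.V := G.finite
  have : Fintype G.V := Fintype.ofFinite _
  have : Nontrivial G.V := ⟨⟨G.root, G.null, G.root_ne_null⟩⟩
  obtain ⟨N, hN⟩ : ∃ N, Fintype.card G.V = N + 2 :=
    ⟨Fintype.card G.V - 2, by have := Fintype.one_lt_card (α := G.V); omega⟩
  let e₀ : G.V ≃ Fin (N + 2) := Fintype.equivFinOfCardEq hN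
  let e₁ : G.V ≃ Fin (N + 2) := e₀.trans (Equiv.swap (e₀ G.null) 0)
  have h₁ : e₁ G.null = 0 := by simp [e₁]
  let e : G.V ≃ Fin (N + 2) := e₁.trans (Equiv.swap (e₁ G.root) 1)
  have hroot : e G.root = 1 := by simp [e]
  have hnull : e G.null = 0 := by
    have h : e₁ G.root ≠ 0 := fun h => G.root_ne_null (e₁.injective (h.trans h₁.symm))
    simp only [e, Equiv.trans_apply, h₁]
    exact Equiv.swap_apply_of_ne_of_ne h.symm (by simp)
  have key : ∀ r : G.V → G.V → Prop, (∀ x, r G.null x ↔ x = G.null) → ∃ E : List (ℕ × ℕ),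
      ∀ x y, r x y ↔ (e x = 0 ∧ e y = 0) ∨ (e x ≠ 0 ∧ ((e x : ℕ), (e y : ℕ)) ∈ E) := by
    intro r hr
    refine ⟨((Finset.univ.filter fun q : G.V × G.V => r q.1 q.2).toList).map
      fun q => ((e q.1 : ℕ), (e q.2 : ℕ)), fun x y => ?_⟩
    have hx : ∀ z, e z = 0 ↔ z = G.null := fun z => by rw [← hnull, e.apply_eq_iff_eq]
    by_cases h : x = G.null
    · subst h
      simp [hr, hx]
    · simp [hx, h, Fin.val_inj]
  obtain ⟨E₁, hE₁⟩ := key G.s₁ G.null_s₁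
  obtain ⟨E₂, hE₂⟩ := key G.s₂ G.null_s₂
  exact ⟨(N, E₁, E₂), e, hE₁, hE₂, hnull, hroot⟩

/-- The data of a PCP instance: a finite sequence of pairs of words over the alphabet `ℕ` (of which
only finitely many letters occur). -/
abbrev PCPData : Type := List (List ℕ × List ℕ)

/-- All words of the sequence are nonempty, so that it is a PCP instance. -/
def IsPCPInstance (I : PCPData) : Prop := ∀ p ∈ I, p.1 ≠ [] ∧ p.2 ≠ []

/-- The instance `⟨v₀, w₀⟩, …, ⟨v_{m-1}, w_{m-1}⟩` has a solution: a nonempty sequence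
`t₀, …, t_{k-1}` of indices with `v_{t₀} ⋯ v_{t_{k-1}} = w_{t₀} ⋯ w_{t_{k-1}}`. -/
def HasPCPSolution (I : PCPData) : Prop :=
  ∃ t : List (Fin I.length), t ≠ [] ∧
    t.flatMap (fun i => (I.get i).1) = t.flatMap (fun i => (I.get i).2)

end RegGraph

/-!
The Post correspondence problem is reduced to satisfiability over corresponder graphs, and it is
shown to be undecidable itself, as Mathlib has the halting problem but not this one.

*From PCP to graphs.* A solution `t₀, …, t_{k-1}` of an instance with `v_{t₀} ⋯ v_{t_{k-1}} =
w_{t₀} ⋯ w_{t_{k-1}}`, a word of length `n`, is described by a corresponder graph in which the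
`i`-th letter is represented by `U_{2i}, U_{2i+1}` as a letter of the words `v` and by
`L_{2i}, L_{2i+1}` as a letter of the words `w`; the words `v_{t_j}` and `w_{t_j}` start at the
places `u_j` and `l_j`. A homomorphism to the graph `PCPGraph.graphCode` labels each `U` and `L`
node with a position in a word of the instance, and each `C` node with a pair of the instance. Edges
within a row force positions to advance correctly, edges between the rows compare letters, and the
edges from `C_{2j}` and `C_{2j+1}` make the `j`-th words of both rows belong to the same pair. What
remains is that a row must not contain words that no `C` node points to. Therefore the label of
`U_{2i}` tells that of `L_{2i}` whether a word starts there, and `L_{2i}` has to have an edge to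
`root` or to `null` accordingly; as such an edge goes to `root` exactly if `i` is some `u_j`, the
words of the upper row start exactly at the `u_j`. The nodes with odd indices do the same for the
lower row. `Reading.flatMap_eq_of_isReading` and `Reading.exists_isReading` translate between
sequences of positions and concatenations of words.

*Undecidability of PCP.* A Turing machine `TM0` with finitely many states is simulated by a finite
string rewriting system (`TuringRewriting.eval_dom_iff_reflTransGen`), and derivability in such a
system is expressed by PCP (`StringRewriting.hasPCPSolution_startTile_cons_iff`). The usual trouble
of forcing a solution to begin with the start tile is avoided by marking all symbols with a bit that
is flipped whenever a symbol is copied or rewritten: then the two words of any other tile begin with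
different letters. Mathlib's
compilation of partial recursive functions to Turing machines provides a universal machine
(`PCP.exists_universal_machine`), and only the start tile depends on its input.
-/

namespace RegGraph

/-- A solution of a PCP instance may be given by the list of its pairs, instead of their indices. -/
theorem hasPCPSolution_iff {I : PCPData} :
    HasPCPSolution I ↔ ∃ A : PCPData, A ≠ [] ∧ (∀ p ∈ A, p ∈ I) ∧
      A.flatMap Prod.fst = A.flatMap Prod.snd := by
  constructor
  · rintro ⟨t, ht, h⟩
    refine ⟨t.map I.get, by simpa using ht, ?_, by simpa [List.flatMap_map] using h⟩
    simp only [List.mem_map]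
    rintro _ ⟨i, -, rfl⟩
    exact List.get_mem _ _
  · rintro ⟨A, hA, hm, h⟩
    have : A ∈ Set.range (List.map I.get) := by
      rw [Set.range_list_map]
      intro p hp
      obtain ⟨i, hi⟩ := List.get_of_mem (hm p hp)
      exact ⟨i, hi⟩
    obtain ⟨t, rfl⟩ := this
    exact ⟨t, by simpa using hA, by simpa [List.flatMap_map] using h⟩

end RegGraph

/-! ### From string rewriting to the Post correspondence problem -/

namespace StringRewriting

open RegGraph Relation

variable {σ : Type*}

/-- Two lists that are split at their first element with property `P` are equal only if the parts
are. -/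
theorem append_cons_inj {α : Type*} {P : α → Prop} {x₁ x₂ y₁ y₂ : List α} {a₁ a₂ : α}
    (hx₁ : ∀ a ∈ x₁, ¬ P a) (hx₂ : ∀ a ∈ x₂, ¬ P a) (h₁ : P a₁) (h₂ : P a₂)
    (h : x₁ ++ a₁ :: y₁ = x₂ ++ a₂ :: y₂) : x₁ = x₂ ∧ a₁ = a₂ ∧ y₁ = y₂ := by
  induction x₁ generalizing x₂ with
  | nil =>
    cases x₂ with
    | nil => simpa using h
    | cons b x₂ =>
      simp only [List.nil_append, List.cons_append, List.cons.injEq] at h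
      exact absurd (h.1 ▸ h₁) (hx₂ b (by simp))
  | cons b x₁ ih =>
    cases x₂ with
    | nil =>
      simp only [List.nil_append, List.cons_append, List.cons.injEq] at h
      exact absurd (h.1 ▸ h₂) (hx₁ b (by simp))
    | cons b' x₂ =>
      simp only [List.cons_append, List.cons.injEq] at h
      obtain ⟨rfl, h'⟩ := ih (fun a ha => hx₁ a (by simp [ha])) (fun a ha => hx₂ a (by simp [ha])) h.2
      simp [h.1, h']

/-- `y` arises from `x` by replacing a factor `u` by `v`, where `R u v`. -/
def Rewrites (R : List σ → List σ → Prop) (x y : List σ) : Prop :=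
  ∃ p u v s, R u v ∧ x = p ++ u ++ s ∧ y = p ++ v ++ s

theorem Rewrites.of_rule {R : List σ → List σ → Prop} {u v : List σ} (h : R u v) (p s : List σ) :
    Rewrites R (p ++ u ++ s) (p ++ v ++ s) := ⟨p, u, v, s, h, rfl, rfl⟩

/-- The letter of the PCP alphabet that stands for the symbol `a` with mark `b`. The letters `0` and
`1` are kept free for the start tile and the final tiles. -/
def letter (e : σ → ℕ) (b : Bool) (a : σ) : ℕ := 2 * e a + b.toNat + 2

/-- The word `x` with all symbols marked by `b`. -/
def word (e : σ → ℕ) (b : Bool) (x : List σ) : List ℕ := x.map (letter e b)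

/-- The tiles that simulate rewriting by `R` until `f` is reached. Copying and rewriting flip the mark,
so that none but the start tile has two words that begin with the same letter. -/
inductive Tile (e : σ → ℕ) (R : List σ → List σ → Prop) (f : List σ) : List ℕ × List ℕ → Prop
  | copy (b : Bool) (a : σ) : Tile e R f (word e b [a], word e (!b) [a])
  | rule (b : Bool) (u v : List σ) (h : R u v) : Tile e R f (word e b u, word e (!b) v)
  | final (b : Bool) : Tile e R f (word e b f ++ [1], [1])

/-- The tile that writes down the word `x` from which rewriting starts. -/
def startTile (e : σ → ℕ) (x : List σ) : List ℕ × List ℕ := ([0], 0 :: word e false x)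

section Letters

variable {e : σ → ℕ}

@[simp] theorem word_nil (b : Bool) : word e b [] = [] := rfl

@[simp] theorem word_cons (b : Bool) (a : σ) (x : List σ) :
    word e b (a :: x) = letter e b a :: word e b x := rfl

@[simp] theorem word_append (b : Bool) (x y : List σ) :
    word e b (x ++ y) = word e b x ++ word e b y := List.map_append

theorem letter_ne_zero (b : Bool) (a : σ) : letter e b a ≠ 0 := by simp [letter]

theorem letter_ne_one (b : Bool) (a : σ) : letter e b a ≠ 1 := by simp only [letter]; omega

theorem letter_eq_letter (he : Function.Injective e) {b b' : Bool} {a a' : σ}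
    (h : letter e b a = letter e b' a') : b = b' ∧ a = a' := by
  have : b = b' ∧ e a = e a' := by
    cases b <;> cases b' <;> simp [letter] at h ⊢ <;> omega
  exact ⟨this.1, he this.2⟩

theorem letter_ne_letter_not (he : Function.Injective e) (b : Bool) (a a' : σ) :
    letter e b a ≠ letter e (!b) a' := fun h => by simpa using (letter_eq_letter he h).1

theorem one_notMem_word (b : Bool) (x : List σ) : 1 ∉ word e b x := by
  simp only [word, List.mem_map, not_exists, not_and]
  exact fun a _ => letter_ne_one b a

theorem word_eq_word (he : Function.Injective e) {b b' : Bool} {x x' : List σ} (hx : x ≠ [])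
    (h : word e b x = word e b' x') : b = b' ∧ x = x' := by
  induction x generalizing x' with
  | nil => exact absurd rfl hx
  | cons a x ih =>
    cases x' with
    | nil => simp at h
    | cons a' x' =>
      simp only [word_cons, List.cons.injEq] at h
      obtain ⟨rfl, rfl⟩ := letter_eq_letter he h.1
      by_cases hx' : x = []
      · subst hx'
        have : x' = [] := by simpa [word] using h.2.symm
        simp [this]
      · simp [(ih hx' h.2).2]

/-- A word of one mark that is matched against a longer text, in which a word of that mark is
followed by a nonempty word of the other mark, ends before the mark changes. -/
theorem exists_append_of_word_append (he : Function.Injective e) {b : Bool} {u x z : List σ}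
    {T B : List ℕ} (hz : z ≠ []) (h : word e b u ++ T = word e b x ++ (word e (!b) z ++ B)) :
    ∃ x', x = u ++ x' ∧ T = word e b x' ++ (word e (!b) z ++ B) := by
  induction u generalizing x with
  | nil => exact ⟨x, rfl, h⟩
  | cons a u ih =>
    cases x with
    | nil =>
      obtain ⟨c, z, rfl⟩ := List.exists_cons_of_ne_nil hz
      simp only [word_cons, word_nil, List.nil_append, List.cons_append, List.cons.injEq] at h
      exact absurd h.1 (letter_ne_letter_not he _ _ _)
    | cons a' x =>
      simp only [word_cons, List.cons_append, List.cons.injEq] at h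
      obtain ⟨x', rfl, hT⟩ := ih h.2
      exact ⟨x', by rw [(letter_eq_letter he h.1).2]; rfl, hT⟩

end Letters

variable {e : σ → ℕ} {R : List σ → List σ → Prop} {f : List σ}

theorem exists_copy_tiles (b : Bool) (x : List σ) : ∃ A : PCPData, (∀ p ∈ A, Tile e R f p) ∧
    A.flatMap Prod.fst = word e b x ∧ A.flatMap Prod.snd = word e (!b) x := by
  refine ⟨x.map fun a => (word e b [a], word e (!b) [a]), ?_, ?_, ?_⟩
  · simp only [List.mem_map]
    rintro _ ⟨a, -, rfl⟩
    exact .copy b a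
  all_goals
    induction x with
    | nil => rfl
    | cons a x ih => rw [List.map_cons, List.flatMap_cons, ih]; rfl

/-- A derivation of `f` from `x` is turned into tiles whose lower words lag behind by `x`. -/
theorem exists_tiles_of_reflTransGen {x : List σ} (h : ReflTransGen (Rewrites R) x f) (b : Bool) :
    ∃ A : PCPData, (∀ p ∈ A, Tile e R f p) ∧
      A.flatMap Prod.fst = word e b x ++ A.flatMap Prod.snd := by
  induction h using ReflTransGen.head_induction_on generalizing b with
  | refl => exact ⟨[_], by simpa using Tile.final b, by simp⟩
  | head h _ ih =>
    obtain ⟨p, u, v, s, huv, rfl, rfl⟩ := h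
    obtain ⟨A, hA, hA'⟩ := ih (!b)
    obtain ⟨P, hP, hP₁, hP₂⟩ := exists_copy_tiles (e := e) (R := R) (f := f) b p
    obtain ⟨S, hS, hS₁, hS₂⟩ := exists_copy_tiles (e := e) (R := R) (f := f) b s
    refine ⟨P ++ (word e b u, word e (!b) v) :: (S ++ A), ?_, ?_⟩
    · simp only [List.mem_append, List.mem_cons]
      rintro q (hq | rfl | hq | hq)
      exacts [hP q hq, .rule b u v huv, hS q hq, hA q hq]
    · simp [hP₁, hP₂, hS₁, hS₂, hA']

/-- While a solution is being read off, the text by which the lower words are ahead consists of the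
part `x` of the current word that is still to be rewritten and the part `y` of the next word that
has been produced. -/
theorem reflTransGen_of_tiles (he : Function.Injective e) (hf : f ≠ [])
    (hR : ∀ u v, R u v → u ≠ [] ∧ v ≠ []) {x₀ : List σ} (A : PCPData)
    (hA : ∀ p ∈ A, p = startTile e x₀ ∨ Tile e R f p) (b : Bool) (x y : List σ) (hx : x ≠ [])
    (h : A.flatMap Prod.fst = word e b x ++ (word e (!b) y ++ A.flatMap Prod.snd)) :
    ReflTransGen (Rewrites R) (y ++ x) f := by
  induction A generalizing b x y with
  | nil =>
    obtain ⟨a, x, rfl⟩ := List.exists_cons_of_ne_nil hx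
    simp at h
  | cons t A ih =>
    have hA' : ∀ p ∈ A, p = startTile e x₀ ∨ Tile e R f p := fun p hp => hA p (by simp [hp])
    -- copy tiles and rule tiles are used in the same way
    have key : ∀ b' u v, u ≠ [] → v ≠ [] → t = (word e b' u, word e (!b') v) →
        ∃ x', x = u ++ x' ∧ ReflTransGen (Rewrites R) (y ++ v ++ x') f := by
      rintro b' u v hu hv rfl
      simp only [List.flatMap_cons] at h
      obtain rfl : b' = b := by
        obtain ⟨a, u, rfl⟩ := List.exists_cons_of_ne_nil hu
        obtain ⟨c, x, rfl⟩ := List.exists_cons_of_ne_nil hx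
        simp only [word_cons, List.cons_append, List.cons.injEq] at h
        exact (letter_eq_letter he h.1).1
      obtain ⟨x', rfl, hT⟩ := exists_append_of_word_append he (z := y ++ v)
        (B := A.flatMap Prod.snd) (by simp [hv]) (by simpa using h)
      refine ⟨x', rfl, ?_⟩
      by_cases hx' : x' = []
      · subst hx'
        simpa using ih hA' (!b') (y ++ v) [] (by simp [hv]) (by simpa using hT)
      · simpa using ih hA' b' x' (y ++ v) hx' hT
    rcases hA t (by simp) with rfl | ht
    · obtain ⟨a, x, rfl⟩ := List.exists_cons_of_ne_nil hx
      simp only [startTile, List.flatMap_cons, word_cons, List.cons_append, List.cons.injEq] at h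
      exact absurd h.1.symm (letter_ne_zero _ _)
    · cases ht with
      | copy b' a =>
        obtain ⟨x', rfl, hx'⟩ := key b' [a] [a] (by simp) (by simp) rfl
        simpa using hx'
      | rule b' u v huv =>
        obtain ⟨x', rfl, hx'⟩ := key b' u v (hR u v huv).1 (hR u v huv).2 rfl
        refine .head ?_ hx'
        simpa using Rewrites.of_rule huv y x'
      | final b' =>
        simp only [List.flatMap_cons, List.append_assoc, List.singleton_append] at h
        rw [← List.append_assoc] at h
        have h₁ : word e b' f = word e b x ++ word e (!b) y := by
          refine (append_cons_inj (P := fun n => n = 1) ?_ ?_ rfl rfl h).1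
          · rintro _ hn rfl
            exact one_notMem_word _ _ hn
          · rintro _ hn rfl
            exact (List.mem_append.1 hn).elim (one_notMem_word _ _) (one_notMem_word _ _)
        obtain rfl : b' = b := by
          obtain ⟨a, f, rfl⟩ := List.exists_cons_of_ne_nil hf
          obtain ⟨c, x, rfl⟩ := List.exists_cons_of_ne_nil hx
          simp only [word_cons, List.cons_append, List.cons.injEq] at h₁
          exact (letter_eq_letter he h₁.1).1
        obtain rfl : y = [] := by
          by_contra hy
          obtain ⟨f', rfl, hf'⟩ := exists_append_of_word_append (T := []) (B := []) he hy
            (by simpa using h₁)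
          obtain ⟨a, y, rfl⟩ := List.exists_cons_of_ne_nil hy
          simp at hf'
        rw [(word_eq_word he hf (by simpa using h₁)).2]
        exact .refl

/-- The Post correspondence problem for the tiles of a rewriting system. -/
theorem hasPCPSolution_startTile_cons_iff (he : Function.Injective e) (hf : f ≠ [])
    (hR : ∀ u v, R u v → u ≠ [] ∧ v ≠ []) {I : PCPData} (hI : ∀ p, p ∈ I ↔ Tile e R f p)
    {x : List σ} (hx : x ≠ []) :
    HasPCPSolution (startTile e x :: I) ↔ ReflTransGen (Rewrites R) x f := by
  rw [hasPCPSolution_iff]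
  constructor
  · rintro ⟨A, hA, hm, h⟩
    simp only [List.mem_cons, hI] at hm
    obtain ⟨t, A, rfl⟩ := List.exists_cons_of_ne_nil hA
    have key : ∀ b u v, u ≠ [] → v ≠ [] → t ≠ (word e b u, word e (!b) v) := by
      rintro b u v hu hv rfl
      obtain ⟨a, u, rfl⟩ := List.exists_cons_of_ne_nil hu
      obtain ⟨c, v, rfl⟩ := List.exists_cons_of_ne_nil hv
      simp only [List.flatMap_cons, word_cons, List.cons_append, List.cons.injEq] at h
      exact letter_ne_letter_not he _ _ _ h.1
    rcases hm t (by simp) with rfl | ht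
    · have := reflTransGen_of_tiles he hf hR A (fun p hp => hm p (by simp [hp])) false x [] hx
        (by simpa [startTile] using h)
      simpa using this
    · cases ht with
      | copy b a => exact absurd rfl (key b [a] [a] (by simp) (by simp))
      | rule b u v huv => exact absurd rfl (key b u v (hR u v huv).1 (hR u v huv).2)
      | final b =>
        obtain ⟨a, f, rfl⟩ := List.exists_cons_of_ne_nil hf
        simp only [List.flatMap_cons, word_cons, List.cons_append, List.cons.injEq] at h
        exact absurd h.1 (letter_ne_one _ _)
  · intro h
    obtain ⟨A, hA, hA'⟩ := exists_tiles_of_reflTransGen (e := e) h false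
    refine ⟨startTile e x :: A, by simp, ?_, by simp [startTile, hA']⟩
    simp only [List.mem_cons, hI]
    exact fun p hp => hp.imp_right (hA p)

theorem isPCPInstance_startTile_cons (hR : ∀ u v, R u v → u ≠ [] ∧ v ≠ [])
    {I : PCPData} (hI : ∀ p ∈ I, Tile e R f p) (x : List σ) :
    IsPCPInstance (startTile e x :: I) := by
  intro p hp
  rcases List.mem_cons.1 hp with rfl | hp
  · simp [startTile]
  · cases hI p hp with
    | copy b a => simp
    | rule b u v h => simpa [word] using hR u v h
    | final b => simp

/-- A rewriting system with finitely many symbols and rules has finitely many tiles. -/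
theorem finite_setOf_tile [Finite σ] (hR : {q : List σ × List σ | R q.1 q.2}.Finite) :
    {p | Tile e R f p}.Finite := by
  refine ((Set.finite_range fun q : Bool × σ => (word e q.1 [q.2], word e (!q.1) [q.2])).union
    (((Set.finite_univ (α := Bool)).prod hR).image
      fun q => (word e q.1 q.2.1, word e (!q.1) q.2.2)) |>.union
    (Set.finite_range fun b : Bool => (word e b f ++ [1], [1]))).subset ?_
  rintro _ (⟨b, a⟩ | ⟨b, u, v, h⟩ | ⟨b⟩)
  · exact .inl (.inl ⟨(b, a), rfl⟩)
  · exact .inl (.inr ⟨(b, u, v), ⟨trivial, h⟩, rfl⟩)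
  · exact .inr ⟨b, rfl⟩

end StringRewriting

/-! ### Turing machines as string rewriting systems -/

namespace TuringRewriting

open StringRewriting Relation Turing

/-- The symbols of the words that describe configurations of a Turing machine: tape symbols, states,
end markers on both sides, and a symbol that announces that the machine has halted. -/
inductive CfgSymbol (Γ S : Type*)
  | tape (a : Γ)
  | state (q : S)
  | left
  | right
  | halt

open CfgSymbol

instance {Γ S : Type*} [Finite Γ] [Finite S] : Finite (CfgSymbol Γ S) := by
  refine Finite.of_injective (β := Γ ⊕ S ⊕ Fin 3) (fun x => match x with
    | tape a => .inl a
    | state q => .inr (.inl q)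
    | left => .inr (.inr 0)
    | right => .inr (.inr 1)
    | halt => .inr (.inr 2)) ?_
  rintro (a | q | _ | _ | _) (a' | q' | _ | _ | _) h <;> simp_all

variable {Γ Λ : Type*} {S : Set Λ}

/-- The word that describes the machine in state `q` with the tape contents `l` to the left of the
head and `r` from the head on. -/
def cfgWord (l : List Γ) (q : S) (r : List Γ) : List (CfgSymbol Γ S) :=
  (left :: l.map tape) ++ state q :: (r.map tape ++ [right])

theorem eq_of_cfgWord_eq {l : List Γ} {q q' : S} {r : List Γ} {x y : List (CfgSymbol Γ S)}
    (h : cfgWord l q r = x ++ state q' :: y) :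
    x = left :: l.map tape ∧ q' = q ∧ y = r.map tape ++ [right] := by
  obtain ⟨h₁, h₂, h₃⟩ := (List.append_cons_inj_of_notMem (by simp) (by simp)).1 h
  exact ⟨h₁.symm, by simpa using h₂.symm, h₃.symm⟩

theorem exists_eq_cons {r : List Γ} {a : Γ} {s : List (CfgSymbol Γ S)}
    (h : tape a :: s = r.map tape ++ [right]) : ∃ r', r = a :: r' ∧ s = r'.map tape ++ [right] := by
  cases r with
  | nil => simp at h
  | cons b r =>
    simp only [List.map_cons, List.cons_append, List.cons.injEq, CfgSymbol.tape.injEq] at h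
    exact ⟨r, by rw [h.1], h.2⟩

theorem exists_eq_append {l : List Γ} {c : Γ} {p : List (CfgSymbol Γ S)}
    (h : p ++ [tape c] = left :: l.map tape) :
    ∃ l', l = l' ++ [c] ∧ p = left :: l'.map tape := by
  rcases l.eq_nil_or_concat' with rfl | ⟨l, b, rfl⟩
  · simpa using congrArg List.getLast? h
  · rw [List.map_append, ← List.cons_append] at h
    obtain ⟨rfl, h₂⟩ := List.append_inj' h rfl
    exact ⟨l, by simpa using h₂.symm, rfl⟩

theorem halt_notMem_cfgWord (l : List Γ) (q : S) (r : List Γ) : halt ∉ cfgWord l q r := by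
  simp [cfgWord]

variable [Inhabited Γ]

/-- The configuration described by `cfgWord l q r`. -/
def cfg (l : List Γ) (q : Λ) (r : List Γ) : TM0.Cfg Γ Λ :=
  ⟨q, Tape.mk' (ListBlank.mk l.reverse) (ListBlank.mk r)⟩

theorem mk_nil_eq_mk_default : (ListBlank.mk [] : ListBlank Γ) = ListBlank.mk [default] := by
  exact (ListBlank.cons_head_tail _).symm

theorem cfg_nil_right (l : List Γ) (q : Λ) : cfg l q [] = cfg l q [default] := by
  rw [cfg, cfg, mk_nil_eq_mk_default]

theorem cfg_nil_left (q : Λ) (r : List Γ) : cfg [] q r = cfg [default] q r := by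
  rw [cfg, cfg, List.reverse_nil, mk_nil_eq_mk_default]; rfl

variable [Inhabited Λ]

/-- The rewriting rules that simulate the machine `M` with states in `S`. A state symbol stands to
the left of the scanned tape symbol. Blanks are supplied next to an end marker on demand, and the
tape is erased after the machine has halted. -/
inductive Rule (M : TM0.Machine Γ Λ) (S : Set Λ) :
    List (CfgSymbol Γ S) → List (CfgSymbol Γ S) → Prop
  | halt (q : S) (a : Γ) (h : M q.1 a = none) : Rule M S [state q, tape a] [halt]
  | write (q q' : S) (a b : Γ) (h : M q.1 a = some (q'.1, .write b)) :
      Rule M S [state q, tape a] [state q', tape b]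
  | moveRight (q q' : S) (a : Γ) (h : M q.1 a = some (q'.1, .move .right)) :
      Rule M S [state q, tape a] [tape a, state q']
  | moveLeft (q q' : S) (a c : Γ) (h : M q.1 a = some (q'.1, .move .left)) :
      Rule M S [tape c, state q, tape a] [state q', tape c, tape a]
  | extendRight (q : S) : Rule M S [state q, right] [state q, tape default, right]
  | extendLeft (q : S) : Rule M S [left, state q] [left, tape default, state q]
  | eraseRight (c : Γ) : Rule M S [halt, tape c] [halt]
  | eraseLeft (c : Γ) : Rule M S [tape c, halt] [halt]

variable {M : TM0.Machine Γ Λ}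

theorem Rule.ne_nil {u v : List (CfgSymbol Γ S)} (h : Rule M S u v) : u ≠ [] ∧ v ≠ [] := by
  cases h <;> simp

theorem finite_setOf_rule [Finite Γ] [Finite S] :
    {p : List (CfgSymbol Γ S) × List (CfgSymbol Γ S) | Rule M S p.1 p.2}.Finite := by
  refine ((List.finite_length_le (CfgSymbol Γ S) 3).prod (List.finite_length_le _ 3)).subset ?_
  rintro ⟨u, v⟩ h
  constructor <;> cases h <;> simp

theorem step_cfg_none {q : Λ} {a : Γ} (h : M q a = none) (l r : List Γ) :
    TM0.step M (cfg l q (a :: r)) = none := by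
  simp [TM0.step, cfg, h]

theorem step_cfg_write {q q' : Λ} {a b : Γ} (h : M q a = some (q', .write b)) (l r : List Γ) :
    TM0.step M (cfg l q (a :: r)) = some (cfg l q' (b :: r)) := by
  simp only [TM0.step, cfg, Tape.mk'_head, ListBlank.head_mk, List.headI_cons, h]
  simp [Tape.write_mk', ListBlank.cons_mk]

theorem step_cfg_moveRight {q q' : Λ} {a : Γ} (h : M q a = some (q', .move .right))
    (l r : List Γ) : TM0.step M (cfg l q (a :: r)) = some (cfg (l ++ [a]) q' r) := by
  simp only [TM0.step, cfg, Tape.mk'_head, ListBlank.head_mk, List.headI_cons, h]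
  simp [Tape.move_right_mk', ListBlank.cons_mk]

theorem step_cfg_moveLeft {q q' : Λ} {a : Γ} (h : M q a = some (q', .move .left))
    (l : List Γ) (c : Γ) (r : List Γ) :
    TM0.step M (cfg (l ++ [c]) q (a :: r)) = some (cfg l q' (c :: a :: r)) := by
  simp only [TM0.step, cfg, Tape.mk'_head, ListBlank.head_mk, List.headI_cons, h]
  simp [Tape.move_left_mk', ListBlank.cons_mk]

/-! ### Simulation of the machine by rewriting -/

/-- Blanks may be supplied on both sides of the head, so that the next step takes place within the
word. -/
theorem exists_extend (l : List Γ) (q : S) (r : List Γ) : ∃ l' c a r',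
    cfg (l' ++ [c]) q.1 (a :: r') = cfg l q.1 r ∧
      ReflTransGen (Rewrites (Rule M S)) (cfgWord l q r) (cfgWord (l' ++ [c]) q (a :: r')) := by
  obtain ⟨a, r', hr, hr'⟩ : ∃ a r', cfg l q.1 (a :: r') = cfg l q.1 r ∧
      ReflTransGen (Rewrites (Rule M S)) (cfgWord l q r) (cfgWord l q (a :: r')) := by
    rcases r with _ | ⟨a, r⟩
    · refine ⟨default, [], (cfg_nil_right _ _).symm, .single ?_⟩
      simpa [cfgWord] using Rewrites.of_rule (Rule.extendRight (M := M) q) (left :: l.map tape) []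
    · exact ⟨a, r, rfl, .refl⟩
  rcases l.eq_nil_or_concat' with rfl | ⟨l, c, rfl⟩
  · refine ⟨[], default, a, r', ?_, hr'.tail ?_⟩
    · rw [← hr, cfg_nil_left]; rfl
    · simpa [cfgWord] using Rewrites.of_rule (Rule.extendLeft (M := M) q) []
        (tape a :: (r'.map tape ++ [right]))
  · exact ⟨l, c, a, r', hr, hr'⟩

theorem exists_cfgWord_of_step (hS : TM0.Supports M S) {l : List Γ} {q : S} {r : List Γ}
    {c' : TM0.Cfg Γ Λ} (h : c' ∈ TM0.step M (cfg l q.1 r)) : ∃ l' q' r', c' = cfg l' q'.1 r' ∧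
      ReflTransGen (Rewrites (Rule M S)) (cfgWord l q r) (cfgWord l' q' r') := by
  obtain ⟨l₁, c, a, r₁, hc, hw⟩ := exists_extend (M := M) l q r
  rw [← hc] at h
  rcases hM : M q.1 a with _ | ⟨q', (_ | _) | b⟩
  · simp [step_cfg_none hM] at h
  all_goals let q'' : S := ⟨q', hS.2 hM q.2⟩
  · rw [step_cfg_moveLeft hM, Option.mem_some_iff] at h
    refine ⟨l₁, q'', c :: a :: r₁, h.symm, hw.tail ?_⟩
    simpa [cfgWord] using Rewrites.of_rule (Rule.moveLeft q q'' a c hM) (left :: l₁.map tape)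
      (r₁.map tape ++ [right])
  · rw [step_cfg_moveRight hM, Option.mem_some_iff] at h
    refine ⟨(l₁ ++ [c]) ++ [a], q'', r₁, h.symm, hw.tail ?_⟩
    simpa [cfgWord] using Rewrites.of_rule (Rule.moveRight q q'' a hM)
      (left :: (l₁ ++ [c]).map tape) (r₁.map tape ++ [right])
  · rw [step_cfg_write hM, Option.mem_some_iff] at h
    refine ⟨l₁ ++ [c], q'', b :: r₁, h.symm, hw.tail ?_⟩
    simpa [cfgWord] using Rewrites.of_rule (Rule.write q q'' a b hM)
      (left :: (l₁ ++ [c]).map tape) (r₁.map tape ++ [right])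

theorem exists_cfgWord_of_reaches (hS : TM0.Supports M S) {l : List Γ} {q : S} {r : List Γ}
    {c' : TM0.Cfg Γ Λ} (h : StateTransition.Reaches (TM0.step M) (cfg l q.1 r) c') :
    ∃ l' q' r', c' = cfg l' q'.1 r' ∧
      ReflTransGen (Rewrites (Rule M S)) (cfgWord l q r) (cfgWord l' q' r') := by
  induction h with
  | refl => exact ⟨l, q, r, rfl, .refl⟩
  | tail _ h ih =>
    obtain ⟨l₁, q₁, r₁, rfl, hw⟩ := ih
    obtain ⟨l₂, q₂, r₂, rfl, hw'⟩ := exists_cfgWord_of_step hS h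
    exact ⟨l₂, q₂, r₂, rfl, hw.trans hw'⟩

theorem erase_right (p : List (CfgSymbol Γ S)) (r : List Γ) : ReflTransGen (Rewrites (Rule M S))
    (p ++ halt :: (r.map tape ++ [right])) (p ++ [halt, right]) := by
  induction r with
  | nil => exact .refl
  | cons c r ih =>
    refine .head ?_ ih
    simpa using Rewrites.of_rule (Rule.eraseRight (M := M) (S := S) c) p (r.map tape ++ [right])

theorem erase_left (l : List Γ) : ReflTransGen (Rewrites (Rule M S))
    (left :: l.map tape ++ [halt, right]) [left, halt, right] := by
  induction l using List.reverseRecOn with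
  | nil => exact .refl
  | append_singleton l c ih =>
    refine .head ?_ ih
    simpa using Rewrites.of_rule (Rule.eraseLeft (M := M) (S := S) c) (left :: l.map tape) [right]

theorem reflTransGen_of_halts {l : List Γ} {q : S} {r : List Γ}
    (h : TM0.step M (cfg l q.1 r) = none) :
    ReflTransGen (Rewrites (Rule M S)) (cfgWord l q r) [left, halt, right] := by
  obtain ⟨l₁, c, a, r₁, hc, hw⟩ := exists_extend (M := M) l q r
  replace h : M q.1 a = none := by
    rw [← hc] at h
    simpa [TM0.step, cfg] using h
  refine (hw.tail ?_).trans ((erase_right (left :: (l₁ ++ [c]).map tape) r₁).trans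
    (erase_left (l₁ ++ [c])))
  simpa [cfgWord] using Rewrites.of_rule (Rule.halt q a h) (left :: (l₁ ++ [c]).map tape)
    (r₁.map tape ++ [right])

/-! ### Rewriting only simulates the machine -/

/-- A rewriting step on the word of a configuration leads to the word of the same configuration or
of the next one, unless the machine halts. -/
theorem halts_or_exists_cfgWord {l : List Γ} {q : S} {r : List Γ} {w : List (CfgSymbol Γ S)}
    (h : Rewrites (Rule M S) (cfgWord l q r) w) : TM0.step M (cfg l q.1 r) = none ∨
      ∃ l' q' r', w = cfgWord l' q' r' ∧
        StateTransition.Reaches (TM0.step M) (cfg l q.1 r) (cfg l' q'.1 r') := by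
  obtain ⟨p, u, v, s, huv, hw, rfl⟩ := h
  cases huv with
  | halt q' a h =>
    obtain ⟨rfl, rfl, h₃⟩ := eq_of_cfgWord_eq (x := p) (y := tape a :: s) (by simpa using hw)
    obtain ⟨r, rfl, rfl⟩ := exists_eq_cons h₃
    exact .inl (step_cfg_none h _ _)
  | write q' q'' a b h =>
    obtain ⟨rfl, rfl, h₃⟩ := eq_of_cfgWord_eq (x := p) (y := tape a :: s) (by simpa using hw)
    obtain ⟨r, rfl, rfl⟩ := exists_eq_cons h₃
    exact .inr ⟨l, q'', b :: r, by simp [cfgWord], .single (step_cfg_write h _ _)⟩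
  | moveRight q' q'' a h =>
    obtain ⟨rfl, rfl, h₃⟩ := eq_of_cfgWord_eq (x := p) (y := tape a :: s) (by simpa using hw)
    obtain ⟨r, rfl, rfl⟩ := exists_eq_cons h₃
    exact .inr ⟨l ++ [a], q'', r, by simp [cfgWord], .single (step_cfg_moveRight h _ _)⟩
  | moveLeft q' q'' a c h =>
    obtain ⟨h₁, rfl, h₃⟩ := eq_of_cfgWord_eq (x := p ++ [tape c]) (y := tape a :: s)
      (by simpa using hw)
    obtain ⟨r, rfl, rfl⟩ := exists_eq_cons h₃
    obtain ⟨l, rfl, rfl⟩ := exists_eq_append h₁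
    exact .inr ⟨l, q'', c :: a :: r, by simp [cfgWord], .single (step_cfg_moveLeft h _ _ _)⟩
  | extendRight q' =>
    obtain ⟨rfl, rfl, h₃⟩ := eq_of_cfgWord_eq (x := p) (y := right :: s) (by simpa using hw)
    obtain ⟨rfl, rfl⟩ : r = [] ∧ s = [] := by
      cases r <;> simp at h₃ ⊢
      exact h₃
    refine .inr ⟨l, q', [default], by simp [cfgWord], ?_⟩
    rw [cfg_nil_right]
    exact .refl
  | extendLeft q' =>
    obtain ⟨h₁, rfl, rfl⟩ := eq_of_cfgWord_eq (x := p ++ [left]) (y := s) (by simpa using hw)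
    obtain ⟨rfl, rfl⟩ : l = [] ∧ p = [] := by
      rcases l.eq_nil_or_concat' with rfl | ⟨l, b, rfl⟩
      · exact ⟨rfl, by simpa using congrArg List.length h₁⟩
      · rw [List.map_append, ← List.cons_append] at h₁
        simpa using (List.append_inj' h₁ rfl).2
    refine .inr ⟨[default], q', r, by simp [cfgWord], ?_⟩
    rw [cfg_nil_left]
    exact .refl
  | eraseRight c =>
    refine absurd ?_ (halt_notMem_cfgWord l q r)
    simp [hw]
  | eraseLeft c =>
    refine absurd ?_ (halt_notMem_cfgWord l q r)
    simp [hw]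

/-- The machine halts if and only if its initial word can be rewritten to the word that is left after
halting and erasing the tape. -/
theorem eval_dom_iff_reflTransGen (hS : TM0.Supports M S) (r : List Γ) :
    (TM0.eval M r).Dom ↔ ReflTransGen (Rewrites (Rule M S)) (cfgWord [] ⟨default, hS.1⟩ r)
      [left, halt, right] := by
  have hdom : (TM0.eval M r).Dom ↔ ∃ c, StateTransition.Reaches (TM0.step M)
      (cfg [] default r) c ∧ TM0.step M c = none := by
    have : (TM0.eval M r).Dom ↔ (StateTransition.eval (TM0.step M) (cfg [] default r)).Dom := Iff.rfl
    rw [this, Part.dom_iff_mem]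
    simp only [StateTransition.mem_eval]
  rw [hdom]
  constructor
  · rintro ⟨c, hc, hn⟩
    obtain ⟨l, q, r', rfl, hw⟩ := exists_cfgWord_of_reaches hS (q := ⟨default, hS.1⟩) hc
    exact hw.trans (reflTransGen_of_halts hn)
  · intro h
    have key : ∀ w, ReflTransGen (Rewrites (Rule M S)) (cfgWord [] ⟨default, hS.1⟩ r) w →
        (∃ c, StateTransition.Reaches (TM0.step M) (cfg [] default r) c ∧
          TM0.step M c = none) ∨
        ∃ l q r', w = cfgWord l q r' ∧
          StateTransition.Reaches (TM0.step M) (cfg [] default r) (cfg l q.1 r') := by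
      intro w hw
      induction hw with
      | refl => exact .inr ⟨_, _, _, rfl, .refl⟩
      | tail _ hs ih =>
        rcases ih with ih | ⟨l, q, r', rfl, hr⟩
        · exact .inl ih
        · rcases halts_or_exists_cfgWord hs with hn | ⟨l', q', r'', rfl, hr'⟩
          · exact .inl ⟨_, hr, hn⟩
          · exact .inr ⟨l', q', r'', rfl, hr.trans hr'⟩
    rcases key _ h with h | ⟨l, q, r', hw, -⟩
    · exact h
    · exact absurd (hw ▸ by simp) (halt_notMem_cfgWord l q r')

end TuringRewriting

/-! ### Undecidability of the Post correspondence problem -/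

namespace PCP

open RegGraph StringRewriting TuringRewriting Turing
open Nat.Partrec (Code)

/-- A universal program, fed with powers of two because the binary representation of `2 ^ m`, which
is what the input tape holds, is a simple function of `m`. -/
theorem exists_universal_code : ∃ c : ToPartrec.Code, ∀ m : ℕ,
    (c.eval [2 ^ m]).Dom ↔ ((Denumerable.ofNat Code m).eval 0).Dom := by
  let f : ℕ →. ℕ := fun n => (Nat.rfind fun m => Part.some (decide (2 ^ m = n))).bind
    fun m => (Denumerable.ofNat Code m).eval 0
  have hpow : Computable fun m : ℕ => 2 ^ m := by
    have : Primrec fun m : ℕ => 2 ^ m :=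
      (Primrec.nat_rec₁ 1 (Primrec.nat_mul.comp Primrec.snd (Primrec.const 2)).to₂).of_eq
        fun m => by induction m with
          | zero => rfl
          | succ m ih => rw [pow_succ, ← ih]
    exact this.to_comp
  have hf : Partrec f := by
    refine Partrec.bind (Partrec.rfind (p := fun n m => Part.some (decide (2 ^ m = n))) ?_) ?_
    · refine Computable₂.partrec₂ ?_
      exact (Primrec.eq (α := ℕ)).decide.to_comp.comp (hpow.comp .snd) .fst
    · exact (Code.eval_part.comp ((Computable.ofNat Code).comp .snd) (.const 0)).to₂
  obtain ⟨c, hc⟩ := ToPartrec.Code.exists_code (Nat.Partrec'.part_iff₁.2 hf)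
  refine ⟨c, fun m => ?_⟩
  have hm : (Nat.rfind fun m' => Part.some (decide (2 ^ m' = 2 ^ m))) = Part.some m := by
    refine Part.eq_some_iff.2 (Nat.mem_rfind.2 ⟨by simp, fun {m'} h => ?_⟩)
    simpa using h.ne
  have h := hc ⟨[2 ^ m], rfl⟩
  simp only [List.Vector.head] at h
  rw [show c.eval [2 ^ m] = _ from h]
  have hf : f (2 ^ m) = (Denumerable.ofNat Code m).eval 0 := by
    simp only [f]
    rw [hm, Part.bind_some]
  rw [hf]
  simp

theorem trNat_two_pow (m : ℕ) : PartrecToTM2.trNat (2 ^ m) =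
    List.replicate m PartrecToTM2.Γ'.bit0 ++ [PartrecToTM2.Γ'.bit1] := by
  have h : ∀ m : ℕ, ∃ p : PosNum, ((2 ^ m : ℕ) : Num) = .pos p ∧
      PartrecToTM2.trPosNum p =
        List.replicate m PartrecToTM2.Γ'.bit0 ++ [PartrecToTM2.Γ'.bit1] := by
    intro m
    induction m with
    | zero => exact ⟨.one, by simp; rfl, rfl⟩
    | succ m ih =>
      obtain ⟨p, hp, hp'⟩ := ih
      refine ⟨.bit0 p, ?_, by rw [PartrecToTM2.trPosNum, hp', List.replicate_succ]; rfl⟩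
      rw [pow_succ, mul_two, Nat.cast_add, hp, Num.bit0_of_bit0]
      rfl
  obtain ⟨p, hp, hp'⟩ := h m
  rw [PartrecToTM2.trNat, hp, PartrecToTM2.trNum, hp']

theorem exists_trInit_two_pow : ∃ a b c : TM2to1.Γ' PartrecToTM2.K' fun _ => PartrecToTM2.Γ',
    ∀ m : ℕ, TM2to1.trInit PartrecToTM2.K'.main (PartrecToTM2.trList [2 ^ m]) =
      a :: b :: List.replicate m c := by
  refine ⟨(true, Function.update (fun _ => none) PartrecToTM2.K'.main (some .cons)),
    (false, Function.update (fun _ => none) PartrecToTM2.K'.main (some .bit1)),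
    (false, Function.update (fun _ => none) PartrecToTM2.K'.main (some .bit0)), fun m => ?_⟩
  rw [PartrecToTM2.trList, trNat_two_pow, PartrecToTM2.trList]
  simp only [TM2to1.trInit, List.reverse_append, List.reverse_cons, List.reverse_nil,
    List.nil_append, List.reverse_replicate, List.cons_append]
  exact congrArg (fun l => _ :: _ :: l) List.map_replicate

instance : Finite PartrecToTM2.K' := Finite.of_injective (β := Fin 4) (fun k => match k with
  | .main => 0
  | .rev => 1
  | .aux => 2
  | .stack => 3) (by rintro (_ | _) (_ | _) h <;> simp_all)

instance : Finite (TM2to1.Γ' PartrecToTM2.K' fun _ => PartrecToTM2.Γ') :=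
  inferInstanceAs (Finite (Bool × (PartrecToTM2.K' → Option PartrecToTM2.Γ')))

/-- A machine with finitely many symbols and states that takes the number of a program in unary and
halts if and only if the program halts on input `0`. -/
theorem exists_universal_machine : ∃ (Γ Λ : Type) (_ : Inhabited Γ) (_ : Inhabited Λ)
    (_ : Finite Γ) (M : TM0.Machine Γ Λ) (S : Set Λ) (_ : Finite S) (a b c : Γ),
    TM0.Supports M S ∧ ∀ m : ℕ, (TM0.eval M (a :: b :: List.replicate m c)).Dom ↔
      ((Denumerable.ofNat Code m).eval 0).Dom := by
  obtain ⟨p, hp⟩ := exists_universal_code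
  obtain ⟨a, b, c, habc⟩ := exists_trInit_two_pow
  -- the machine starts in its default state, which therefore has to be the start of `p`
  let _ : Inhabited PartrecToTM2.Λ' := ⟨PartrecToTM2.trNormal p .halt⟩
  let M₂ : PartrecToTM2.Λ' →
      TM2.Stmt (fun _ : PartrecToTM2.K' => PartrecToTM2.Γ') PartrecToTM2.Λ' (Option PartrecToTM2.Γ') :=
    PartrecToTM2.tr
  have hS₂ := PartrecToTM2.tr_supports p .halt
  have hS := TM1to0.tr_supports (TM2to1.tr M₂) (TM2to1.tr_supports M₂ hS₂)
  refine ⟨_, _, inferInstance, inferInstance, inferInstance, TM1to0.tr (TM2to1.tr M₂), _,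
    Finset.finite_toSet _, a, b, c, hS, fun m => ?_⟩
  rw [TM1to0.tr_eval, ← habc, TM2to1.tr_eval_dom, ← hp]
  have hinit : (TM2.init PartrecToTM2.K'.main (PartrecToTM2.trList [2 ^ m]) : PartrecToTM2.Cfg') =
      PartrecToTM2.init p [2 ^ m] := by
    simp only [TM2.init, PartrecToTM2.init]
    congr 1
    funext k
    cases k <;> rfl
  have hdom : (TM2.eval M₂ PartrecToTM2.K'.main (PartrecToTM2.trList [2 ^ m])).Dom ↔
      (StateTransition.eval (TM2.step PartrecToTM2.tr) (PartrecToTM2.init p [2 ^ m])).Dom := by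
    rw [← hinit]; rfl
  rw [hdom, PartrecToTM2.tr_eval]
  rfl

/-- The halting problem is reducible to the Post correspondence problem. -/
theorem exists_reduction_from_halting : ∃ g : Code → PCPData, Computable g ∧
    ∀ c, IsPCPInstance (g c) ∧ (HasPCPSolution (g c) ↔ (c.eval 0).Dom) := by
  obtain ⟨Γ, Λ, _, _, _, M, S, _, a, b, c, hS, hM⟩ := exists_universal_machine
  obtain ⟨e, he⟩ : ∃ e : CfgSymbol Γ S → ℕ, Function.Injective e :=
    let ⟨f, hf⟩ := Finite.exists_equiv_fin (CfgSymbol Γ S)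
    ⟨fun x => hf.some x, Fin.val_injective.comp hf.some.injective⟩
  let f : List (CfgSymbol Γ S) := [.left, .halt, .right]
  obtain ⟨I, hI⟩ : ∃ I : PCPData, ∀ p, p ∈ I ↔ Tile e (Rule M S) f p :=
    ⟨(finite_setOf_tile (e := e) (f := f)
      (finite_setOf_rule (M := M) (S := S))).toFinset.toList, fun p => by simp⟩
  let x (m : ℕ) : List (CfgSymbol Γ S) := cfgWord [] ⟨default, hS.1⟩ (a :: b :: List.replicate m c)
  have hR : ∀ u v, Rule M S u v → u ≠ [] ∧ v ≠ [] := fun u v h => h.ne_nil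
  refine ⟨fun p => startTile e (x (Encodable.encode p)) :: I, ?_, fun p => ⟨?_, ?_⟩⟩
  · -- the start tile consists of fixed words and a letter that is repeated `m` times
    obtain ⟨w₁, n, w₂, hw⟩ : ∃ (w₁ : List ℕ) (n : ℕ) (w₂ : List ℕ), ∀ m : ℕ,
        startTile e (x m) = ([0], w₁ ++ ((List.range m).map (fun _ => n) ++ w₂)) :=
      ⟨0 :: word e false [.left, .state ⟨default, hS.1⟩, .tape a, .tape b], letter e false (.tape c),
        word e false [.right], fun m => by simp [startTile, x, cfgWord, word]⟩
    simp only [hw]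
    refine Primrec.to_comp ?_
    refine Primrec.list_cons.comp (Primrec.pair (.const _) ?_) (.const _)
    refine Primrec.list_append.comp (.const _) (Primrec.list_append.comp ?_ (.const _))
    exact Primrec.list_map (Primrec.list_range.comp Primrec.encode) (Primrec.const n).to₂
  · exact isPCPInstance_startTile_cons hR (fun p => (hI p).1) _
  · rw [hasPCPSolution_startTile_cons_iff he (by simp [f]) hR hI (by simp [x, cfgWord]),
      ← eval_dom_iff_reflTransGen hS, hM, Denumerable.ofNat_encode]

end PCP

/-! ### Reading a concatenation of words letter by letter -/

namespace Reading

variable {W : ℕ → List ℕ}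

/-- The pair `(t, p)` stands for position `p` of the word `W t`. `Step W x y` says that `y` may be
next to `x` in a concatenation of words: it is the next position of the same word, or the first
position of some word if `x` is the last position of its word. -/
def Step (W : ℕ → List ℕ) (x y : ℕ × ℕ) : Prop :=
  (y.1 = x.1 ∧ y.2 = x.2 + 1 ∧ y.2 < (W x.1).length) ∨ (x.2 + 1 = (W x.1).length ∧ y.2 = 0)

/-- The position is the last one of its word. -/
def IsLast (W : ℕ → List ℕ) (x : ℕ × ℕ) : Prop := x.2 + 1 = (W x.1).length

/-- The letter at a position. -/
def letterAt (W : ℕ → List ℕ) (x : ℕ × ℕ) : ℕ := (W x.1).getD x.2 0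

/-- The positions `a 0, …, a (n - 1)` are those of the concatenation of the words with indices
`T 0, …, T (k - 1)`, which start at the places `u 0, …, u (k - 1)`. -/
structure IsReading (W : ℕ → List ℕ) {n k : ℕ} (T : Fin k → ℕ) (u : Fin k → Fin n)
    (a : ℕ → ℕ × ℕ) : Prop where
  step : ∀ i, i + 1 < n → Step W (a i) (a (i + 1))
  last : IsLast W (a (n - 1))
  start_iff : ∀ i : Fin n, (a i).2 = 0 ↔ ∃ j, u j = i
  start_eq : ∀ j, a (u j) = (T j, 0)

/-- A sequence of positions that begins within a word spells the rest of that word, followed by the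
words that start later in the sequence. -/
theorem map_letterAt_cons (l : List (ℕ × ℕ)) (x : ℕ × ℕ) (hl : (x :: l).IsChain (Step W))
    (hlast : ∀ y ∈ (x :: l).getLast?, IsLast W y) :
    (x :: l).map (letterAt W) =
      (W x.1).drop x.2 ++ (l.filter fun y => y.2 = 0).flatMap fun y => W y.1 := by
  have hdrop (x : ℕ × ℕ) (h : x.2 < (W x.1).length) :
      (W x.1).drop x.2 = letterAt W x :: (W x.1).drop (x.2 + 1) := by
    rw [List.drop_eq_getElem_cons h, letterAt, List.getD_eq_getElem _ _ h]
  induction l generalizing x with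
  | nil =>
    have h : x.2 + 1 = (W x.1).length := hlast x rfl
    rw [hdrop x (by omega), h]
    simp
  | cons y l ih =>
    rw [List.isChain_cons_cons] at hl
    rw [List.map_cons, ih y hl.2 (by simpa using hlast)]
    rcases hl.1 with ⟨h₁, h₂, h₃⟩ | ⟨h₁, h₂⟩
    · rw [hdrop x (by omega), h₁, h₂]
      simp [h₂]
    · rw [hdrop x (by omega), h₁]
      simp [h₂]

theorem flatMap_eq_of_isReading {n k : ℕ} [NeZero n] {T : Fin k → ℕ} {u : Fin k → Fin n}
    {a : ℕ → ℕ × ℕ} (hu : StrictMono u) (h : IsReading W T u a) (h0 : (a 0).2 = 0) :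
    (List.ofFn T).flatMap W = (List.range n).map fun i => letterAt W (a i) := by
  -- the starting places are listed in increasing order by `u`
  have hfilter : (List.finRange n).filter (fun i : Fin n => (a i).2 = 0) = List.ofFn u := by
    refine ((List.sortedLT_finRange n).pairwise.filter _).eq_of_mem_iff hu.sortedLT_ofFn.pairwise ?_
    intro i
    simp [h.start_iff, List.mem_ofFn]
  have hrange : (List.range n).map a = (List.finRange n).map fun i : Fin n => a i := by
    rw [← List.map_coe_finRange_eq_range, List.map_map]; rfl
  obtain ⟨m, rfl⟩ : ∃ m, n = m + 1 := ⟨n - 1, by have := NeZero.pos n; omega⟩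
  have hcons : (List.range (m + 1)).map a = a 0 :: ((List.range m).map fun i => a (i + 1)) := by
    rw [List.range_succ_eq_map, List.map_cons, List.map_map]; rfl
  have key := map_letterAt_cons (W := W) ((List.range m).map fun i => a (i + 1)) (a 0) ?_ ?_
  · rw [← hcons, List.map_map, h0, List.drop_zero] at key
    refine Eq.trans ?_ key.symm
    have : W (a 0).1 ++ (((List.range m).map fun i => a (i + 1)).filter
        fun y => y.2 = 0).flatMap (fun y => W y.1) =
        (((List.range (m + 1)).map a).filter fun y => y.2 = 0).flatMap (fun y => W y.1) := by
      rw [hcons]; simp [h0]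
    rw [this, hrange, List.filter_map, Function.comp_def, hfilter, List.flatMap_map,
      List.ofFn_eq_map, List.ofFn_eq_map, List.flatMap_map, List.flatMap_map]
    simp [h.start_eq]
  · rw [← hcons, List.isChain_iff_getElem]
    intro i hi
    simpa using h.step i (by simpa using hi)
  · rw [← hcons]
    simpa [List.range_succ] using h.last

/-- The positions of a concatenation of words, in order. -/
def positions (W : ℕ → List ℕ) (T : List ℕ) : List (ℕ × ℕ) :=
  T.flatMap fun t => (List.range (W t).length).map fun p => (t, p)

theorem map_letterAt_positions (T : List ℕ) : (positions W T).map (letterAt W) = T.flatMap W := by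
  rw [positions, List.map_flatMap]
  congr 1
  funext t
  refine List.ext_getElem (by simp) fun i h₁ h₂ => ?_
  simp [letterAt, h₂]

theorem filter_positions (T : List ℕ) (hT : ∀ t ∈ T, W t ≠ []) :
    (positions W T).filter (fun x => x.2 = 0) = T.map fun t => (t, 0) := by
  induction T with
  | nil => rfl
  | cons t T ih =>
    obtain ⟨m, hm⟩ : ∃ m, (W t).length = m + 1 :=
      ⟨(W t).length - 1, by have := List.length_pos_iff.2 (hT t (by simp)); omega⟩
    have ih := ih fun s hs => hT s (by simp [hs])
    rw [positions] at ih ⊢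
    rw [List.flatMap_cons, List.filter_append, ih, hm, List.range_succ_eq_map]
    simp [List.filter_map, Function.comp_def]

theorem isChain_positions (T : List ℕ) (hT : ∀ t ∈ T, W t ≠ []) :
    (positions W T).IsChain (Step W) ∧ (∀ x ∈ (positions W T).head?, x.2 = 0) ∧
      ∀ x ∈ (positions W T).getLast?, IsLast W x := by
  induction T with
  | nil => simp [positions]
  | cons t T ih =>
    obtain ⟨m, hm⟩ : ∃ m, (W t).length = m + 1 :=
      ⟨(W t).length - 1, by have := List.length_pos_iff.2 (hT t (by simp)); omega⟩
    obtain ⟨ih₁, ih₂, ih₃⟩ := ih fun s hs => hT s (by simp [hs])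
    have hcons : positions W (t :: T) =
        ((List.range (W t).length).map fun p => (t, p)) ++ positions W T := by
      rw [positions, List.flatMap_cons]; rfl
    have hlast : ∀ x ∈ ((List.range (W t).length).map fun p => (t, p)).getLast?, IsLast W x := by
      rw [hm, List.range_succ]
      simp [IsLast, hm]
    rw [hcons]
    refine ⟨List.IsChain.append ?_ ih₁ ?_, ?_, ?_⟩
    · rw [List.isChain_iff_getElem]
      intro i hi
      simp only [List.length_map, List.length_range] at hi
      simpa [Step] using hi
    · exact fun x hx y hy => .inr ⟨hlast x hx, ih₂ y hy⟩
    · rw [hm, List.range_succ_eq_map]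
      simp
    · intro x hx
      rw [List.getLast?_append] at hx
      cases h : (positions W T).getLast? with
      | none => exact hlast x (by simpa [h] using hx)
      | some y =>
        rw [h] at hx
        obtain rfl : y = x := by simpa using hx
        exact ih₃ y h

theorem mem_positions {T : List ℕ} {x : ℕ × ℕ} :
    x ∈ positions W T ↔ x.1 ∈ T ∧ x.2 < (W x.1).length := by
  simp only [positions, List.mem_flatMap, List.mem_map, List.mem_range]
  constructor
  · rintro ⟨t, ht, p, hp, rfl⟩
    exact ⟨ht, hp⟩
  · rintro ⟨h₁, h₂⟩
    exact ⟨_, h₁, _, h₂, rfl⟩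

theorem exists_isReading (T : List ℕ) (hT : ∀ t ∈ T, W t ≠ []) (hne : T ≠ []) :
    ∃ (u : Fin T.length → Fin (T.flatMap W).length) (a : ℕ → ℕ × ℕ), StrictMono u ∧
      (∀ j : Fin T.length, (j : ℕ) = 0 → (u j : ℕ) = 0) ∧ IsReading W T.get u a ∧
      (∀ i < (T.flatMap W).length, (a i).1 ∈ T ∧ (a i).2 < (W (a i).1).length) ∧
      ∀ i (hi : i < (T.flatMap W).length), letterAt W (a i) = (T.flatMap W)[i] := by
  obtain ⟨hchain, hhead, hlast⟩ := isChain_positions T hT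
  have hlen : (T.flatMap W).length = (positions W T).length := by
    rw [← map_letterAt_positions, List.length_map]
  let a : ℕ → ℕ × ℕ := fun i => (positions W T).getD i (0, 0)
  have ha : ∀ i (hi : i < (positions W T).length), a i = (positions W T)[i] := fun i hi =>
    List.getD_eq_getElem _ _ hi
  have hpos : positions W T = (List.finRange (T.flatMap W).length).map fun i : Fin _ => a i := by
    refine List.ext_getElem (by simp [hlen]) fun i h₁ h₂ => ?_
    simp [ha i h₁]
  -- the starting places, in increasing order
  let s := (List.finRange (T.flatMap W).length).filter fun i : Fin _ => (a i).2 = 0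
  have hs : s.map (fun i : Fin _ => a i) = T.map fun t => (t, 0) := by
    rw [← filter_positions T hT, hpos, List.filter_map]
    rfl
  have hslen : T.length = s.length := by simpa using (congrArg List.length hs).symm
  have hsort : s.SortedLT := ((List.sortedLT_finRange _).pairwise.filter _).sortedLT
  let u : Fin T.length → Fin (T.flatMap W).length := fun j => s.get (j.cast hslen)
  have hu : StrictMono u := fun i j hij => hsort.strictMono_get (by simpa using hij)
  have hstart : ∀ i : Fin _, (a i).2 = 0 ↔ ∃ j, u j = i := by
    intro i
    have : (a i).2 = 0 ↔ i ∈ s := by simp [s]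
    rw [this, List.mem_iff_get]
    exact ⟨fun ⟨j, hj⟩ => ⟨j.cast hslen.symm, hj⟩, fun ⟨j, hj⟩ => ⟨_, hj⟩⟩
  have hn : 0 < (T.flatMap W).length := by
    obtain ⟨t, ht⟩ := List.exists_mem_of_ne_nil T hne
    exact List.length_pos_of_ne_nil fun h => hT t ht (List.flatMap_eq_nil_iff.1 h t ht)
  refine ⟨u, a, hu, fun j hj => ?_, ⟨fun i hi => ?_, ?_, hstart, fun j => ?_⟩, fun i hi => ?_,
    fun i hi => ?_⟩
  · obtain ⟨j', hj'⟩ := (hstart ⟨0, hn⟩).1 <| hhead _ <| by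
      rw [ha 0 (by omega), List.head?_eq_getElem?]
      simp
    have : u j ≤ u j' := hu.monotone (by simp [Fin.le_def, hj])
    rw [hj'] at this
    simpa [Fin.le_def] using this
  · rw [ha i (by omega), ha (i + 1) (by omega)]
    exact List.isChain_iff_getElem.1 hchain i (by omega)
  · refine hlast _ ?_
    rw [ha _ (by omega), List.getLast?_eq_getElem?]
    simp only [hlen, Option.mem_def]
    exact List.getElem?_eq_getElem _
  · have h₁ := congrArg (·[(j : ℕ)]?) hs
    simpa [u, ← hslen] using h₁
  · rw [← mem_positions, ha i (by omega)]
    exact List.getElem_mem _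
  · rw [ha i (by omega)]
    simp only [← map_letterAt_positions (W := W) T, List.getElem_map]

end Reading

/-! ### The graph of an instance of the Post correspondence problem -/

namespace PCPGraph

open RegGraph Reading

/-- The first word of the `t`-th pair. -/
def upper (I : PCPData) (t : ℕ) : List ℕ := (I.getD t ([], [])).1

/-- The second word of the `t`-th pair. -/
def lower (I : PCPData) (t : ℕ) : List ℕ := (I.getD t ([], [])).2

/-- The nodes of the graph of an instance are triples `(kind, t, p)`, where `(t, p)` stands for
position `p` of one of the words of the `t`-th pair. The triples with kind `0` that matter are
`(0, 0, 0)`, which is `null`, and `(0, 0, 1)`, which is `root`. A homomorphism maps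
* `C_{2j}` to kind `1` and `C_{2j+1}` to kind `2`, where `t` is the `j`-th index of the solution
  and `p = 0`;
* `U_{2i}` to kind `3` and `U_{2i+1}` to kind `4` or `5`, where `(t, p)` is the position in the
  first words that the `i`-th letter comes from, and `5` says that a second word starts at `i`;
* `L_{2i}` to kind `6` or `7` and `L_{2i+1}` to kind `8`, where `(t, p)` is the position in the
  second words that the `i`-th letter comes from, and `7` says that a first word starts at `i`. -/
abbrev Label : Type := ℕ × ℕ × ℕ

/-- The label of `null`. -/
abbrev nullLabel : Label := (0, 0, 0)

/-- The label of `root`. -/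
abbrev rootLabel : Label := (0, 0, 1)

/-- The `s₁`-edges between labels: they keep the position between the two nodes of a letter, and
move to the next letter otherwise. -/
def Edge₁ (I : PCPData) (x y : Label) : Prop :=
  (x.1 = 0 ∧ y.1 = 1 ∧ y.2.1 < I.length ∧ y.2.2 = 0) ∨
  (x.1 = 1 ∧ y.1 = 2 ∧ y.2 = x.2) ∨
  (x.1 = 2 ∧ ((y.1 = 1 ∧ y.2.1 < I.length ∧ y.2.2 = 0) ∨ y = nullLabel)) ∨
  (x.1 = 3 ∧ (y.1 = 4 ∨ y.1 = 5) ∧ y.2 = x.2) ∨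
  ((x.1 = 4 ∨ x.1 = 5) ∧
    ((y.1 = 3 ∧ Step (upper I) x.2 y.2) ∨ (y = nullLabel ∧ IsLast (upper I) x.2))) ∨
  ((x.1 = 6 ∨ x.1 = 7) ∧ y.1 = 8 ∧ y.2 = x.2) ∨
  (x.1 = 8 ∧ (((y.1 = 6 ∨ y.1 = 7) ∧ Step (lower I) x.2 y.2) ∨
    (y = nullLabel ∧ IsLast (lower I) x.2)))

/-- The `s₂`-edges between labels: they start a word, compare the letters of the two rows, and
announce the start of a word to the other row, which has to confirm it by an edge to `root`. -/
def Edge₂ (I : PCPData) (x y : Label) : Prop :=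
  (x.1 = 0 ∧ y = nullLabel) ∨
  (x.1 = 1 ∧ y.1 = 3 ∧ y.2 = x.2) ∨
  (x.1 = 2 ∧ y.1 = 8 ∧ y.2 = x.2) ∨
  (x.1 = 3 ∧ y.1 = (if x.2.2 = 0 then 7 else 6) ∧
    letterAt (upper I) x.2 = letterAt (lower I) y.2) ∨
  (x.1 = 8 ∧ y.1 = (if x.2.2 = 0 then 5 else 4)) ∨
  ((x.1 = 4 ∨ x.1 = 6) ∧ y = nullLabel) ∨
  ((x.1 = 5 ∨ x.1 = 7) ∧ y = rootLabel)

/-- The number of a label. It is `0` for `nullLabel` and `1` for `rootLabel`. -/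
def labelCode (x : Label) : ℕ := Nat.pair x.1 (Nat.pair x.2.1 x.2.2)

/-- The label with a given number. -/
def labelOfCode (n : ℕ) : Label := (n.unpair.1, n.unpair.2.unpair)

@[simp] theorem labelOfCode_labelCode (x : Label) : labelOfCode (labelCode x) = x := by
  simp [labelOfCode, labelCode]

@[simp] theorem labelCode_labelOfCode (n : ℕ) : labelCode (labelOfCode n) = n := by
  simp [labelOfCode, labelCode]

theorem labelCode_injective : Function.Injective labelCode :=
  Function.LeftInverse.injective labelOfCode_labelCode

theorem labelCode_null : labelCode nullLabel = 0 := rfl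

theorem labelCode_root : labelCode rootLabel = 1 := rfl

open Classical in
/-- The list of the pairs of numbers below `N` whose labels are related by `E`. -/
noncomputable def edgeList (E : Label → Label → Prop) (N : ℕ) : List (ℕ × ℕ) :=
  (List.range N).flatMap fun x => (List.range N).filterMap fun y =>
    if E (labelOfCode x) (labelOfCode y) then some (x, y) else none

theorem mem_edgeList {E : Label → Label → Prop} {N x y : ℕ} :
    (x, y) ∈ edgeList E N ↔ x < N ∧ y < N ∧ E (labelOfCode x) (labelOfCode y) := by
  simp [edgeList]

/-- A number that exceeds all parts of the labels in use. -/
def sizeBound (I : PCPData) : ℕ := 9 + (I.length + (I.flatMap fun p => p.1 ++ p.2).length)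

/-- A bound for the numbers of the labels in use. -/
def codeBound (I : PCPData) : ℕ := labelCode (sizeBound I, sizeBound I, sizeBound I)

/-- The code of the graph of an instance. -/
noncomputable def graphCode (I : PCPData) : GraphCode :=
  (codeBound I, edgeList (Edge₁ I) (codeBound I + 2), edgeList (Edge₂ I) (codeBound I + 2))

theorem labelCode_le_codeBound {I : PCPData} {x : Label} (h₁ : x.1 ≤ sizeBound I)
    (h₂ : x.2.1 ≤ sizeBound I) (h₃ : x.2.2 ≤ sizeBound I) : labelCode x ≤ codeBound I := by
  have mono : ∀ {a b c d : ℕ}, a ≤ b → c ≤ d → Nat.pair a c ≤ Nat.pair b d := by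
    intro a b c d hab hcd
    exact (StrictMono.monotone (fun _ _ h => Nat.pair_lt_pair_left c h) hab).trans
      (StrictMono.monotone (fun _ _ h => Nat.pair_lt_pair_right b h) hcd)
  exact mono h₁ (mono h₂ h₃)

/-! ### Computability of the reduction -/

section Primrec

variable {α : Type*} [Primcodable α]

theorem primrec_upper : Primrec₂ upper :=
  (Primrec.fst.comp (Primrec.list_getD ([], []))).to₂

theorem primrec_lower : Primrec₂ lower :=
  (Primrec.snd.comp (Primrec.list_getD ([], []))).to₂

theorem primrecPred_isLast {W : PCPData → ℕ → List ℕ} (hW : Primrec₂ W) {I : α → PCPData}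
    {x : α → ℕ × ℕ} (hI : Primrec I) (hx : Primrec x) :
    PrimrecPred fun a => IsLast (W (I a)) (x a) := by
  refine Primrec.eq.comp (Primrec.succ.comp (Primrec.snd.comp hx)) (Primrec.list_length.comp ?_)
  exact hW.comp hI (Primrec.fst.comp hx)

theorem primrecPred_step {W : PCPData → ℕ → List ℕ} (hW : Primrec₂ W) {I : α → PCPData}
    {x y : α → ℕ × ℕ} (hI : Primrec I) (hx : Primrec x) (hy : Primrec y) :
    PrimrecPred fun a => Step (W (I a)) (x a) (y a) := by
  have hlen := Primrec.list_length.comp (hW.comp hI (Primrec.fst.comp hx))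
  have hs := Primrec.succ.comp (Primrec.snd.comp hx)
  exact ((Primrec.eq.comp (Primrec.fst.comp hy) (Primrec.fst.comp hx)).and
    ((Primrec.eq.comp (Primrec.snd.comp hy) hs).and
      (Primrec.nat_lt.comp (Primrec.snd.comp hy) hlen))).or
    ((Primrec.eq.comp hs hlen).and (Primrec.eq.comp (Primrec.snd.comp hy) (.const 0)))

theorem primrec_letterAt {W : PCPData → ℕ → List ℕ} (hW : Primrec₂ W) {I : α → PCPData}
    {x : α → ℕ × ℕ} (hI : Primrec I) (hx : Primrec x) :
    Primrec fun a => letterAt (W (I a)) (x a) :=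
  (Primrec.list_getD 0).comp (hW.comp hI (Primrec.fst.comp hx)) (Primrec.snd.comp hx)

theorem primrec_labelOfCode : Primrec labelOfCode :=
  (Primrec.fst.comp Primrec.unpair).pair
    (Primrec.unpair.comp (Primrec.snd.comp Primrec.unpair))

theorem primrec_labelCode : Primrec labelCode :=
  Primrec₂.natPair.comp .fst (Primrec₂.natPair.comp (Primrec.fst.comp .snd)
    (Primrec.snd.comp .snd))

variable {I : α → PCPData} {x y : α → Label}

theorem primrecPred_edge₁ (hI : Primrec I) (hx : Primrec x) (hy : Primrec y) :
    PrimrecPred fun a => Edge₁ (I a) (x a) (y a) := by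
  have kx : ∀ n, PrimrecPred fun a => (x a).1 = n := fun n =>
    Primrec.eq.comp (Primrec.fst.comp hx) (.const n)
  have ky : ∀ n, PrimrecPred fun a => (y a).1 = n := fun n =>
    Primrec.eq.comp (Primrec.fst.comp hy) (.const n)
  have hx₂ := Primrec.snd.comp hx
  have hy₂ := Primrec.snd.comp hy
  have heq : PrimrecPred fun a => (y a).2 = (x a).2 := Primrec.eq.comp hy₂ hx₂
  have hnull : PrimrecPred fun a => y a = nullLabel := Primrec.eq.comp hy (.const _)
  have htile : PrimrecPred fun a => (y a).1 = 1 ∧ (y a).2.1 < (I a).length ∧ (y a).2.2 = 0 :=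
    (ky 1).and ((Primrec.nat_lt.comp (Primrec.fst.comp hy₂) (Primrec.list_length.comp hI)).and
      (Primrec.eq.comp (Primrec.snd.comp hy₂) (.const 0)))
  refine ((kx 0).and htile).or <| ((kx 1).and ((ky 2).and heq)).or <|
    ((kx 2).and (htile.or hnull)).or <| ((kx 3).and (((ky 4).or (ky 5)).and heq)).or <|
    (((kx 4).or (kx 5)).and (PrimrecPred.or ((ky 3).and ?_) (hnull.and ?_))).or <|
    (((kx 6).or (kx 7)).and ((ky 8).and heq)).or <|
    (kx 8).and (PrimrecPred.or (((ky 6).or (ky 7)).and ?_) (hnull.and ?_))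
  · exact primrecPred_step primrec_upper hI hx₂ hy₂
  · exact primrecPred_isLast primrec_upper hI hx₂
  · exact primrecPred_step primrec_lower hI hx₂ hy₂
  · exact primrecPred_isLast primrec_lower hI hx₂

theorem primrecPred_edge₂ (hI : Primrec I) (hx : Primrec x) (hy : Primrec y) :
    PrimrecPred fun a => Edge₂ (I a) (x a) (y a) := by
  have kx : ∀ n, PrimrecPred fun a => (x a).1 = n := fun n =>
    Primrec.eq.comp (Primrec.fst.comp hx) (.const n)
  have hy₁ := Primrec.fst.comp hy
  have ky : ∀ n, PrimrecPred fun a => (y a).1 = n := fun n => Primrec.eq.comp hy₁ (.const n)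
  have hx₂ := Primrec.snd.comp hx
  have hy₂ := Primrec.snd.comp hy
  have heq : PrimrecPred fun a => (y a).2 = (x a).2 := Primrec.eq.comp hy₂ hx₂
  have hnull : PrimrecPred fun a => y a = nullLabel := Primrec.eq.comp hy (.const _)
  have hroot : PrimrecPred fun a => y a = rootLabel := Primrec.eq.comp hy (.const _)
  have hstart : PrimrecPred fun a => (x a).2.2 = 0 :=
    Primrec.eq.comp (Primrec.snd.comp hx₂) (.const 0)
  have hif : ∀ m n : ℕ, PrimrecPred fun a => (y a).1 = if (x a).2.2 = 0 then m else n :=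
    fun m n => Primrec.eq.comp hy₁ (Primrec.ite hstart (.const m) (.const n))
  exact ((kx 0).and hnull).or <| ((kx 1).and ((ky 3).and heq)).or <|
    ((kx 2).and ((ky 8).and heq)).or <|
    ((kx 3).and ((hif 7 6).and (Primrec.eq.comp (primrec_letterAt primrec_upper hI hx₂)
      (primrec_letterAt primrec_lower hI hy₂)))).or <|
    ((kx 8).and (hif 5 4)).or <| (((kx 4).or (kx 6)).and hnull).or <|
    ((kx 5).or (kx 7)).and hroot

theorem primrec_edgeList {E : PCPData → Label → Label → Prop}
    (hE : PrimrecPred fun a : PCPData × Label × Label => E a.1 a.2.1 a.2.2) {N : PCPData → ℕ}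
    (hN : Primrec N) : Primrec fun I => edgeList (E I) (N I) := by
  classical
  have h : PrimrecPred fun a : (PCPData × ℕ) × ℕ =>
      E a.1.1 (labelOfCode a.1.2) (labelOfCode a.2) :=
    hE.comp ((Primrec.fst.comp .fst).pair ((primrec_labelOfCode.comp (Primrec.snd.comp .fst)).pair
      (primrec_labelOfCode.comp .snd)))
  refine Primrec.list_flatMap (Primrec.list_range.comp hN) ?_
  refine Primrec.listFilterMap (Primrec.list_range.comp (hN.comp .fst)) ?_
  exact (Primrec.ite h (Primrec.option_some.comp ((Primrec.snd.comp .fst).pair .snd))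
    (.const none)).of_eq fun a => by congr

theorem computable_graphCode : Computable graphCode := by
  have hsize : Primrec sizeBound := by
    refine Primrec.nat_add.comp (.const 9) (Primrec.nat_add.comp .list_length ?_)
    refine Primrec.list_length.comp (Primrec.list_flatMap .id ?_)
    exact (Primrec.list_append.comp (Primrec.fst.comp .snd) (Primrec.snd.comp .snd)).to₂
  have hcode : Primrec codeBound := primrec_labelCode.comp (hsize.pair (hsize.pair hsize))
  have hN : Primrec fun I => codeBound I + 2 := Primrec.nat_add.comp hcode (.const 2)
  have h₁ := primrec_edgeList (E := Edge₁)
    (primrecPred_edge₁ .fst (Primrec.fst.comp .snd) (Primrec.snd.comp .snd)) hN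
  have h₂ := primrec_edgeList (E := Edge₂)
    (primrecPred_edge₂ .fst (Primrec.fst.comp .snd) (Primrec.snd.comp .snd)) hN
  exact (hcode.pair (h₁.pair h₂)).to_comp

end Primrec

/-! ### Homomorphisms as labellings -/

/-- A labelling of the nodes of a corresponder graph that comes from a homomorphism. -/
structure IsLabelling (I : PCPData) (p : CorrParams) (h : CorrNode p.n p.k → Label) : Prop where
  edge₁ : ∀ x y, x ≠ .null → CorrS₁ p x y → Edge₁ I (h x) (h y)
  edge₂ : ∀ x y, x ≠ .null → CorrS₂ p x y → Edge₂ I (h x) (h y)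
  root_iff : ∀ x, h x = rootLabel ↔ x = .root
  null_iff : ∀ x, h x = nullLabel ↔ x = .null

theorem satisfiableOver_isCorresponder_iff {G : Graph} :
    SatisfiableOver IsCorresponder G ↔ ∃ p, MapsTo (CG p) G := by
  constructor
  · rintro ⟨G₀, ⟨p, e, h₁, h₂, hn, hr⟩, h, hh⟩
    refine ⟨p, h ∘ e.symm, ⟨fun x y hxy => ?_, fun x y hxy => ?_, fun x => ?_, fun x => ?_⟩⟩
    · exact hh.map_s₁ _ _ ((h₁ _ _).2 (by simpa using hxy))
    · exact hh.map_s₂ _ _ ((h₂ _ _).2 (by simpa using hxy))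
    · rw [Function.comp_apply, hh.root_iff, e.symm_apply_eq, hr]
    · rw [Function.comp_apply, hh.null_iff, e.symm_apply_eq, hn]
  · rintro ⟨p, h⟩
    exact ⟨CG p, ⟨p, Equiv.refl _, by simp⟩, h⟩

theorem mapsTo_graphCode_iff {I : PCPData} {p : CorrParams} :
    MapsTo (CG p) (GraphCode.toGraph (graphCode I)) ↔
      ∃ h, IsLabelling I p h ∧ ∀ x, labelCode (h x) < codeBound I + 2 := by
  constructor
  · intro hm
    obtain ⟨h, hh⟩ : ∃ h : CorrNode p.n p.k → Fin (codeBound I + 2),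
      IsHom (CG p) (GraphCode.toGraph (graphCode I)) h := hm
    have hroot : ∀ x, labelOfCode (h x) = rootLabel ↔ x = .root := by
      intro x
      rw [← labelCode_injective.eq_iff, labelCode_labelOfCode, labelCode_root]
      refine Iff.trans ?_ (hh.root_iff x)
      exact (Fin.ext_iff (a := h x) (b := 1)).symm
    have hnull : ∀ x, labelOfCode (h x) = nullLabel ↔ x = .null := by
      intro x
      rw [← labelCode_injective.eq_iff, labelCode_labelOfCode, labelCode_null]
      refine Iff.trans ?_ (hh.null_iff x)
      exact (Fin.ext_iff (a := h x) (b := 0)).symm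
    refine ⟨fun x => labelOfCode (h x),
      ⟨fun x y hx hxy => ?_, fun x y hx hxy => ?_, hroot, hnull⟩, fun x => ?_⟩
    · rcases hh.map_s₁ x y hxy with ⟨h0, -⟩ | ⟨-, h'⟩
      · exact absurd ((hh.null_iff x).1 h0) hx
      · exact (mem_edgeList.1 h').2.2
    · rcases hh.map_s₂ x y hxy with ⟨h0, -⟩ | ⟨-, h'⟩
      · exact absurd ((hh.null_iff x).1 h0) hx
      · exact (mem_edgeList.1 h').2.2
    · rw [labelCode_labelOfCode]
      exact (h x).2
  · rintro ⟨h, hh, hlt⟩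
    let g : CorrNode p.n p.k → Fin (codeBound I + 2) := fun x => ⟨labelCode (h x), hlt x⟩
    have hnull : ∀ x, g x = 0 ↔ x = .null := fun x => by
      rw [← hh.null_iff, ← labelCode_injective.eq_iff, labelCode_null, Fin.ext_iff]
      rfl
    refine ⟨g, ⟨fun x y hxy => ?_, fun x y hxy => ?_, fun x => ?_, hnull⟩⟩
    · by_cases hx : x = .null
      · subst hx
        refine .inl ⟨(hnull _).2 rfl, (hnull _).2 ?_⟩
        cases hxy
        rfl
      · refine .inr ⟨fun h0 => hx ((hnull x).1 h0), mem_edgeList.2 ⟨hlt x, hlt y, ?_⟩⟩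
        simpa [g] using hh.edge₁ x y hx hxy
    · by_cases hx : x = .null
      · subst hx
        refine .inl ⟨(hnull _).2 rfl, (hnull _).2 ?_⟩
        cases hxy
        rfl
      · refine .inr ⟨fun h0 => hx ((hnull x).1 h0), mem_edgeList.2 ⟨hlt x, hlt y, ?_⟩⟩
        simpa [g] using hh.edge₂ x y hx hxy
    · refine Iff.trans ?_ (hh.root_iff x)
      rw [← labelCode_injective.eq_iff, labelCode_root]
      exact Fin.ext_iff (a := g x) (b := 1)

end PCPGraph

namespace PCPGraph

open RegGraph Reading

/-! ### From a labelling to a solution -/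

section Soundness

variable {I : PCPData} {p : CorrParams} {h : CorrNode p.n p.k → Label}

theorem IsLabelling.ne_null (hh : IsLabelling I p h) {x : CorrNode p.n p.k} (hx : x ≠ .null) :
    h x ≠ nullLabel := fun h0 => hx ((hh.null_iff x).1 h0)

/-- The labels of the nodes `C_i`, where `T j` is the `j`-th index of the solution. -/
theorem IsLabelling.exists_tiles (hh : IsLabelling I p h) : ∃ T : Fin p.k → ℕ,
    (∀ j, T j < I.length) ∧ (∀ j : Fin p.k, h (.C ⟨2 * j, by omega⟩) = (1, T j, 0)) ∧
      ∀ j : Fin p.k, h (.C ⟨2 * j + 1, by omega⟩) = (2, T j, 0) := by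
  have next : ∀ j (hj : j < p.k), (∃ t < I.length, h (.C ⟨2 * j, by omega⟩) = (1, t, 0)) →
      ∃ t < I.length, h (.C ⟨2 * j, by omega⟩) = (1, t, 0) ∧
        h (.C ⟨2 * j + 1, by omega⟩) = (2, t, 0) := by
    rintro j hj ⟨t, ht, htj⟩
    refine ⟨t, ht, htj, ?_⟩
    have he := hh.edge₁ (.C ⟨2 * j, by omega⟩) (.C ⟨2 * j + 1, by omega⟩) (by simp)
      (.C_next _ _ rfl)
    simp [Edge₁, htj] at he
    exact Prod.ext he.1 he.2
  have key : ∀ j (hj : j < p.k), ∃ t < I.length, h (.C ⟨2 * j, by omega⟩) = (1, t, 0) := by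
    intro j
    induction j with
    | zero =>
      intro hj
      have he := hh.edge₁ .root (.C ⟨2 * 0, by omega⟩) (by simp) (.root _ rfl)
      simp [Edge₁, (hh.root_iff .root).2 rfl] at he
      exact ⟨_, he.2.1, Prod.ext he.1 (Prod.ext rfl he.2.2)⟩
    | succ j ih =>
      intro hj
      obtain ⟨t, -, -, ht⟩ := next j (by omega) (ih (by omega))
      have he := hh.edge₁ (.C ⟨2 * j + 1, by omega⟩) (.C ⟨2 * (j + 1), by omega⟩) (by simp)
        (.C_next _ _ (by simp; omega))
      simp [Edge₁, ht, hh.ne_null] at he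
      exact ⟨_, he.2.1, Prod.ext he.1 (Prod.ext rfl he.2.2)⟩
  choose T hT hT₁ hT₂ using fun j : Fin p.k => next j j.2 (key j j.2)
  exact ⟨T, hT, hT₁, hT₂⟩

/-- The edges from `C` nodes fix the labels of the first letters of words, the edges within a row
propagate them, and the edges between the rows exclude any further starts of words. -/
theorem IsLabelling.exists_isReading (hh : IsLabelling I p h) :
    ∃ (T : Fin p.k → ℕ) (a b : ℕ → ℕ × ℕ), (∀ j, T j < I.length) ∧
      IsReading (upper I) T p.u a ∧ IsReading (lower I) T p.l b ∧
      (a 0).2 = 0 ∧ (b 0).2 = 0 ∧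
      ∀ i < p.n, letterAt (upper I) (a i) = letterAt (lower I) (b i) := by
  obtain ⟨T, hT, hC₁, hC₂⟩ := hh.exists_tiles
  have hn := p.two_le_n
  have hk := p.two_le_k
  have hnull : h .null = nullLabel := (hh.null_iff _).2 rfl
  have hroot : h .root = rootLabel := (hh.root_iff _).2 rfl
  -- the `s₁`-edges of the upper row
  have hUU : ∀ i (hi : i < p.n), (h (.U ⟨2 * i, by omega⟩)).1 = 3 →
      ((h (.U ⟨2 * i + 1, by omega⟩)).1 = 4 ∨ (h (.U ⟨2 * i + 1, by omega⟩)).1 = 5) ∧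
        (h (.U ⟨2 * i + 1, by omega⟩)).2 = (h (.U ⟨2 * i, by omega⟩)).2 := by
    intro i hi hk
    have he := hh.edge₁ (.U ⟨2 * i, by omega⟩) (.U ⟨2 * i + 1, by omega⟩) (by simp)
      (.U_next _ _ rfl)
    simpa [Edge₁, hk] using he
  have hUstep : ∀ i (hi : i + 1 < p.n), (h (.U ⟨2 * i, by omega⟩)).1 = 3 →
      (h (.U ⟨2 * (i + 1), by omega⟩)).1 = 3 ∧ Step (upper I) (h (.U ⟨2 * i, by omega⟩)).2
        (h (.U ⟨2 * (i + 1), by omega⟩)).2 := by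
    intro i hi hk
    obtain ⟨hk', heq⟩ := hUU i (by omega) hk
    have he := hh.edge₁ (.U ⟨2 * i + 1, by omega⟩) (.U ⟨2 * (i + 1), by omega⟩) (by simp)
      (.U_next _ _ (by simp; omega))
    rcases hk' with hk' | hk' <;> simpa [Edge₁, hk', heq, hh.ne_null] using he
  have hU : ∀ i (hi : i < p.n), (h (.U ⟨2 * i, by omega⟩)).1 = 3 := by
    intro i
    induction i with
    | zero =>
      intro hi
      have he := hh.edge₂ (.C ⟨2 * 0, by omega⟩) (.U ⟨2 * 0, by omega⟩) (by simp)
        (.C_even ⟨0, by omega⟩ _ _ rfl (by simp [p.u_zero]))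
      have := hC₁ ⟨0, by omega⟩
      simp only at this
      simp only [Edge₂, this] at he
      simpa using And.left (by simpa using he)
    | succ i ih => exact fun hi => (hUstep i hi (ih (by omega))).1
  have hCU : ∀ j, (h (.U ⟨2 * p.u j, by omega⟩)).2 = (T j, 0) := by
    intro j
    have he := hh.edge₂ (.C ⟨2 * j, by omega⟩) (.U ⟨2 * p.u j, by omega⟩) (by simp)
      (.C_even j _ _ rfl rfl)
    simp [Edge₂, hC₁ j] at he
    exact he.2
  -- the `s₂`-edges from the upper row to the lower one
  have hUL : ∀ i (hi : i < p.n), (h (.L ⟨2 * i, by omega⟩)).1 =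
      (if (h (.U ⟨2 * i, by omega⟩)).2.2 = 0 then 7 else 6) ∧
      letterAt (upper I) (h (.U ⟨2 * i, by omega⟩)).2 =
        letterAt (lower I) (h (.L ⟨2 * i, by omega⟩)).2 := by
    intro i hi
    have he := hh.edge₂ (.U ⟨2 * i, by omega⟩) (.L ⟨2 * i, by omega⟩) (by simp)
      (.U_even ⟨i, hi⟩ _ rfl)
    simpa [Edge₂, hU i hi] using he
  have hLk : ∀ i (hi : i < p.n),
      (h (.L ⟨2 * i, by omega⟩)).1 = 6 ∨ (h (.L ⟨2 * i, by omega⟩)).1 = 7 := by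
    intro i hi
    rw [(hUL i hi).1]
    split_ifs <;> simp
  -- the `s₁`-edges of the lower row
  have hLL : ∀ i (hi : i < p.n), (h (.L ⟨2 * i + 1, by omega⟩)).1 = 8 ∧
      (h (.L ⟨2 * i + 1, by omega⟩)).2 = (h (.L ⟨2 * i, by omega⟩)).2 := by
    intro i hi
    have he := hh.edge₁ (.L ⟨2 * i, by omega⟩) (.L ⟨2 * i + 1, by omega⟩) (by simp)
      (.L_next _ _ rfl)
    rcases hLk i hi with hk | hk <;> simpa [Edge₁, hk] using he
  have hLstep : ∀ i (hi : i + 1 < p.n), Step (lower I) (h (.L ⟨2 * i, by omega⟩)).2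
        (h (.L ⟨2 * (i + 1), by omega⟩)).2 := by
    intro i hi
    have he := hh.edge₁ (.L ⟨2 * i + 1, by omega⟩) (.L ⟨2 * (i + 1), by omega⟩) (by simp)
      (.L_next _ _ (by simp; omega))
    simp [Edge₁, (hLL i (by omega)).1, (hLL i (by omega)).2, hh.ne_null] at he
    exact he.2
  have hCL : ∀ j, (h (.L ⟨2 * p.l j, by omega⟩)).2 = (T j, 0) := by
    intro j
    have he := hh.edge₂ (.C ⟨2 * j + 1, by omega⟩) (.L ⟨2 * p.l j + 1, by omega⟩) (by simp)
      (.C_odd j _ _ rfl rfl)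
    simp [Edge₂, hC₂ j] at he
    rw [← (hLL (p.l j) (p.l j).2).2, he.2]
  -- the `s₂`-edges from the lower row to the upper one
  have hLU : ∀ i (hi : i < p.n), (h (.U ⟨2 * i + 1, by omega⟩)).1 =
      (if (h (.L ⟨2 * i, by omega⟩)).2.2 = 0 then 5 else 4) := by
    intro i hi
    have he := hh.edge₂ (.L ⟨2 * i + 1, by omega⟩) (.U ⟨2 * i + 1, by omega⟩) (by simp)
      (.L_odd ⟨i, hi⟩ _ rfl)
    simpa [Edge₂, (hLL i hi).1, (hLL i hi).2] using he
  let a : ℕ → ℕ × ℕ := fun i => if hi : i < p.n then (h (.U ⟨2 * i, by omega⟩)).2 else 0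
  let b : ℕ → ℕ × ℕ := fun i => if hi : i < p.n then (h (.L ⟨2 * i, by omega⟩)).2 else 0
  have ha : ∀ i (hi : i < p.n), a i = (h (.U ⟨2 * i, by omega⟩)).2 := fun i hi => dif_pos hi
  have hb : ∀ i (hi : i < p.n), b i = (h (.L ⟨2 * i, by omega⟩)).2 := fun i hi => dif_pos hi
  have hau : ∀ j, a (p.u j) = (T j, 0) := fun j => by rw [ha _ (p.u j).2, hCU]
  have hbl : ∀ j, b (p.l j) = (T j, 0) := fun j => by rw [hb _ (p.l j).2, hCL]
  refine ⟨T, a, b, hT, ⟨fun i hi => ?_, ?_, fun i => ⟨fun h0 => ?_, ?_⟩, hau⟩,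
    ⟨fun i hi => ?_, ?_, fun i => ⟨fun h0 => ?_, ?_⟩, hbl⟩, ?_, ?_, fun i hi => ?_⟩
  · rw [ha i (by omega), ha (i + 1) hi]
    exact (hUstep i hi (hU i (by omega))).2
  · have he := hh.edge₁ (.U ⟨2 * (p.n - 1) + 1, by omega⟩) .null (by simp)
      (.U_last _ (by simp; omega))
    obtain ⟨hk, heq⟩ := hUU (p.n - 1) (by omega) (hU _ (by omega))
    rw [ha _ (by omega), ← heq]
    rcases hk with hk | hk <;> simpa [Edge₁, hk, hnull] using he
  · -- without an edge to `root`, the lower row would not confirm the start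
    by_contra hne
    have he := hh.edge₂ (.L ⟨2 * i, by omega⟩) .null (by simp)
      (.L_even_null i _ rfl (by simpa using hne))
    have hk := (hUL i i.2).1
    rw [← ha i i.2, if_pos h0] at hk
    simp [Edge₂, hk, hnull] at he
  · rintro ⟨j, rfl⟩
    rw [hau]
  · rw [hb i (by omega), hb (i + 1) hi]
    exact hLstep i hi
  · have he := hh.edge₁ (.L ⟨2 * (p.n - 1) + 1, by omega⟩) .null (by simp)
      (.L_last _ (by simp; omega))
    obtain ⟨hk, heq⟩ := hLL (p.n - 1) (by omega)
    rw [hb _ (by omega), ← heq]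
    simpa [Edge₁, hk, hnull] using he
  · by_contra hne
    have he := hh.edge₂ (.U ⟨2 * i + 1, by omega⟩) .null (by simp)
      (.U_odd_null i _ rfl (by simpa using hne))
    have hk := hLU i i.2
    rw [← hb i i.2, if_pos h0] at hk
    simp [Edge₂, hk, hnull] at he
  · rintro ⟨j, rfl⟩
    rw [hbl]
  · have := hau ⟨0, by omega⟩
    rw [p.u_zero] at this
    rw [this]
  · have := hbl ⟨0, by omega⟩
    rw [p.l_zero] at this
    rw [this]
  · rw [ha i hi, hb i hi]
    exact (hUL i hi).2

theorem hasPCPSolution_of_isLabelling (hh : IsLabelling I p h) : HasPCPSolution I := by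
  obtain ⟨T, a, b, hT, ha, hb, ha0, hb0, hab⟩ := hh.exists_isReading
  have hn := p.two_le_n
  have hk := p.two_le_k
  have : NeZero p.n := ⟨by omega⟩
  have h₁ := flatMap_eq_of_isReading p.u_strictMono ha ha0
  have h₂ := flatMap_eq_of_isReading p.l_strictMono hb hb0
  refine hasPCPSolution_iff.2 ⟨(List.ofFn T).map fun t => I.getD t ([], []), ?_, ?_, ?_⟩
  · simp only [ne_eq, List.map_eq_nil_iff, List.ofFn_eq_nil_iff]
    omega
  · simp only [List.mem_map, List.mem_ofFn]
    rintro _ ⟨_, ⟨j, rfl⟩, rfl⟩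
    rw [List.getD_eq_getElem _ _ (hT j)]
    exact List.getElem_mem _
  · rw [List.flatMap_map, List.flatMap_map]
    refine h₁.trans (Eq.trans ?_ h₂.symm)
    exact List.map_congr_left fun i hi => hab i (List.mem_range.1 hi)

end Soundness

/-! ### From a solution to a labelling -/

section Completeness

variable {I : PCPData} {p : CorrParams}

/-- The labelling that comes from a solution, where `t` lists the indices of the solution and `a` and
`b` list the positions in the upper and the lower words. -/
def labelling (t : ℕ → ℕ) (a b : ℕ → ℕ × ℕ) {n k : ℕ} : CorrNode n k → Label
  | .null => nullLabel
  | .root => rootLabel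
  | .C i => (if i.1 % 2 = 0 then 1 else 2, t (i / 2), 0)
  | .U i => (if i.1 % 2 = 0 then 3 else if (b (i / 2)).2 = 0 then 5 else 4, a (i / 2))
  | .L i => (if i.1 % 2 = 1 then 8 else if (a (i / 2)).2 = 0 then 7 else 6, b (i / 2))

section Values

variable {t : ℕ → ℕ} {a b : ℕ → ℕ × ℕ} {n k i : ℕ}

theorem labelling_C_even {c : Fin (2 * k)} (hc : (c : ℕ) = 2 * i) :
    labelling t a b (.C c : CorrNode n k) = (1, t i, 0) := by
  simp [labelling, hc]

theorem labelling_C_odd {c : Fin (2 * k)} (hc : (c : ℕ) = 2 * i + 1) :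
    labelling t a b (.C c : CorrNode n k) = (2, t i, 0) := by
  have h : (2 * i + 1) / 2 = i := by omega
  simp [labelling, hc, h]

theorem labelling_U_even {x : Fin (2 * n)} (hx : (x : ℕ) = 2 * i) :
    labelling t a b (.U x : CorrNode n k) = (3, a i) := by
  simp [labelling, hx]

theorem labelling_U_odd {x : Fin (2 * n)} (hx : (x : ℕ) = 2 * i + 1) :
    labelling t a b (.U x : CorrNode n k) = (if (b i).2 = 0 then 5 else 4, a i) := by
  have h : (2 * i + 1) / 2 = i := by omega
  simp [labelling, hx, h]

theorem labelling_L_even {x : Fin (2 * n)} (hx : (x : ℕ) = 2 * i) :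
    labelling t a b (.L x : CorrNode n k) = (if (a i).2 = 0 then 7 else 6, b i) := by
  simp [labelling, hx]

theorem labelling_L_odd {x : Fin (2 * n)} (hx : (x : ℕ) = 2 * i + 1) :
    labelling t a b (.L x : CorrNode n k) = (8, b i) := by
  have h : (2 * i + 1) / 2 = i := by omega
  simp [labelling, hx, h]

end Values

/-- Two readings of the same word with the same indices give a labelling. -/
theorem isLabelling_labelling {t : ℕ → ℕ} {a b : ℕ → ℕ × ℕ}
    (ht : ∀ j < p.k, t j < I.length)
    (ha : IsReading (upper I) (fun j : Fin p.k => t j) p.u a)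
    (hb : IsReading (lower I) (fun j : Fin p.k => t j) p.l b)
    (hab : ∀ i < p.n, letterAt (upper I) (a i) = letterAt (lower I) (b i)) :
    IsLabelling I p (labelling t a b) := by
  have hn := p.two_le_n
  have hk := p.two_le_k
  have ha' : ∀ j, a (p.u j) = (t j, 0) := ha.start_eq
  have hb' : ∀ j, b (p.l j) = (t j, 0) := hb.start_eq
  refine ⟨?_, ?_, ?_, ?_⟩
  · intro x y hxn hxy
    cases hxy with
    | null => exact absurd rfl hxn
    | root i hi =>
      rw [labelling_C_even (i := 0) hi]
      simp [Edge₁, labelling, ht 0 (by omega)]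
    | C_next i j hj =>
      obtain ⟨m, hm | hm⟩ := Nat.even_or_odd' (i : ℕ)
      · rw [labelling_C_even hm, labelling_C_odd (i := m) (by omega)]
        simp [Edge₁]
      · rw [labelling_C_odd hm, labelling_C_even (i := m + 1) (by omega)]
        simp [Edge₁, ht (m + 1) (by omega)]
    | C_last i hi =>
      rw [labelling_C_odd (i := p.k - 1) (by omega)]
      simp [Edge₁, labelling]
    | U_next i j hj =>
      obtain ⟨m, hm | hm⟩ := Nat.even_or_odd' (i : ℕ)
      · rw [labelling_U_even hm, labelling_U_odd (i := m) (by omega)]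
        by_cases h0 : (b m).2 = 0 <;> simp [Edge₁, h0]
      · rw [labelling_U_odd hm, labelling_U_even (i := m + 1) (by omega)]
        by_cases h0 : (b m).2 = 0 <;> simp [Edge₁, h0, ha.step m (by omega)]
    | U_last i hi =>
      rw [labelling_U_odd (i := p.n - 1) (by omega)]
      by_cases h0 : (b (p.n - 1)).2 = 0 <;> simp [Edge₁, h0, ha.last, labelling]
    | L_next i j hj =>
      obtain ⟨m, hm | hm⟩ := Nat.even_or_odd' (i : ℕ)
      · rw [labelling_L_even hm, labelling_L_odd (i := m) (by omega)]
        by_cases h0 : (a m).2 = 0 <;> simp [Edge₁, h0]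
      · rw [labelling_L_odd hm, labelling_L_even (i := m + 1) (by omega)]
        by_cases h0 : (a (m + 1)).2 = 0 <;> simp [Edge₁, h0, hb.step m (by omega)]
    | L_last i hi =>
      rw [labelling_L_odd (i := p.n - 1) (by omega)]
      simp [Edge₁, hb.last, labelling]
  · intro x y hxn hxy
    cases hxy with
    | null => exact absurd rfl hxn
    | root => simp [Edge₂, labelling]
    | C_even i c x hc hx =>
      rw [labelling_C_even hc, labelling_U_even hx]
      simp [Edge₂, ha']
    | C_odd i c x hc hx =>
      rw [labelling_C_odd hc, labelling_L_odd hx]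
      simp [Edge₂, hb']
    | U_even i x hx =>
      rw [labelling_U_even hx, labelling_L_even hx]
      simp [Edge₂, hab i i.2]
    | L_odd i x hx =>
      rw [labelling_L_odd hx, labelling_U_odd hx]
      simp [Edge₂]
    | U_odd_null i x hx hi =>
      have h0 : (b i).2 ≠ 0 := fun h0 => by
        obtain ⟨j, hj⟩ := (hb.start_iff i).1 h0
        exact hi j hj
      rw [labelling_U_odd hx]
      simp [Edge₂, labelling, h0]
    | U_odd_root j x hx =>
      rw [labelling_U_odd hx]
      simp [Edge₂, labelling, hb']
    | L_even_null i x hx hi =>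
      have h0 : (a i).2 ≠ 0 := fun h0 => by
        obtain ⟨j, hj⟩ := (ha.start_iff i).1 h0
        exact hi j hj
      rw [labelling_L_even hx]
      simp [Edge₂, labelling, h0]
    | L_even_root j x hx =>
      rw [labelling_L_even hx]
      simp [Edge₂, labelling, ha']
  all_goals
    rintro (_ | _ | i | i | i) <;> simp [labelling] <;>
      (intro h0; exfalso; revert h0; split_ifs <;> simp)

theorem length_add_length_le_sizeBound {t : ℕ} (ht : t < I.length) :
    9 + (t + ((upper I t).length + (lower I t).length)) ≤ sizeBound I := by
  have h : ∀ q ∈ I, q.1.length + q.2.length ≤ (I.flatMap fun p => p.1 ++ p.2).length := by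
    intro q hq
    rw [List.length_flatMap, ← List.length_append]
    exact List.single_le_sum (by simp) _ (List.mem_map.2 ⟨q, hq, by simp⟩)
  have := h _ (List.getElem_mem ht)
  rw [upper, lower, List.getD_eq_getElem _ _ ht, sizeBound]
  omega

theorem labelCode_labelling_lt {t : ℕ → ℕ} {a b : ℕ → ℕ × ℕ} (ht : ∀ j < p.k, t j < I.length)
    (ha : ∀ i < p.n, (a i).1 < I.length ∧ (a i).2 < (upper I (a i).1).length)
    (hb : ∀ i < p.n, (b i).1 < I.length ∧ (b i).2 < (lower I (b i).1).length)
    (x : CorrNode p.n p.k) : labelCode (labelling t a b x) < codeBound I + 2 := by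
  have h9 : 9 ≤ sizeBound I := by rw [sizeBound]; omega
  refine Nat.lt_succ_of_le ((labelCode_le_codeBound ?_ ?_ ?_).trans (Nat.le_succ _))
  all_goals
    rcases x with _ | _ | i | i | i <;> simp only [labelling]
  any_goals omega
  any_goals (split_ifs <;> omega)
  · have := length_add_length_le_sizeBound (ht (i / 2) (by omega)); omega
  · have := length_add_length_le_sizeBound (ha (i / 2) (by omega)).1; omega
  · have := length_add_length_le_sizeBound (hb (i / 2) (by omega)).1; omega
  · have := length_add_length_le_sizeBound (ha (i / 2) (by omega)).1
    have := (ha (i / 2) (by omega)).2; omega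
  · have := length_add_length_le_sizeBound (hb (i / 2) (by omega)).1
    have := (hb (i / 2) (by omega)).2; omega

theorem exists_mapsTo_of_hasPCPSolution (hI : IsPCPInstance I) (h : HasPCPSolution I) :
    ∃ p, MapsTo (CG p) (GraphCode.toGraph (graphCode I)) := by
  obtain ⟨t, ht, heq⟩ := h
  -- the solution is doubled, because a corresponder graph has at least two tiles
  let T : List ℕ := (t ++ t).map Fin.val
  have hTlt : ∀ s ∈ T, s < I.length := by
    simp only [T, List.mem_map]
    rintro _ ⟨i, -, rfl⟩
    exact i.2
  have hTne : T ≠ [] := by simpa [T] using ht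
  have hTlen : 2 ≤ T.length := by
    have := List.length_pos_iff.2 ht
    simp [T]
    omega
  have hup : ∀ s ∈ T, upper I s ≠ [] := fun s hs => by
    rw [upper, List.getD_eq_getElem _ _ (hTlt s hs)]
    exact (hI _ (List.getElem_mem _)).1
  have hlo : ∀ s ∈ T, lower I s ≠ [] := fun s hs => by
    rw [lower, List.getD_eq_getElem _ _ (hTlt s hs)]
    exact (hI _ (List.getElem_mem _)).2
  have hw : T.flatMap (upper I) = T.flatMap (lower I) := by
    have h₁ : ∀ i : Fin I.length, upper I i = (I.get i).1 := fun i => by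
      rw [upper, List.getD_eq_getElem _ _ i.2]; rfl
    have h₂ : ∀ i : Fin I.length, lower I i = (I.get i).2 := fun i => by
      rw [lower, List.getD_eq_getElem _ _ i.2]; rfl
    simp only [T, List.flatMap_map, h₁, h₂, List.flatMap_append, heq]
  have hn : T.length ≤ (T.flatMap (upper I)).length := by
    rw [List.length_flatMap]
    have := List.length_le_sum_of_one_le (T.map fun s => (upper I s).length) ?_
    · simpa using this
    · simp only [List.mem_map]
      rintro _ ⟨s, hs, rfl⟩
      exact List.length_pos_iff.2 (hup s hs)
  obtain ⟨u, a, hu, hu0, ha, ha', ha''⟩ := Reading.exists_isReading T hup hTne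
  have hlower := Reading.exists_isReading T hlo hTne
  rw [← hw] at hlower
  obtain ⟨l, b, hl, hl0, hb, hb', hb''⟩ := hlower
  let p : CorrParams := ⟨_, _, by omega, hTlen, u, l, hu0 _ rfl, hl0 _ rfl, hu, hl⟩
  let t' : ℕ → ℕ := fun j => T.getD j 0
  have ht' : ∀ j : Fin T.length, T.get j = t' j := fun j => (List.getD_eq_getElem _ _ j.2).symm
  have ht'' : ∀ j < p.k, t' j < I.length := fun j hj => by
    rw [← ht' ⟨j, hj⟩]; exact hTlt _ (List.get_mem _ _)
  have hget : T.get = fun j : Fin T.length => t' j := funext ht'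
  rw [hget] at ha hb
  refine ⟨p, mapsTo_graphCode_iff.2 ⟨labelling t' a b,
    isLabelling_labelling (p := p) ht'' ha hb fun i hi => ?_,
    labelCode_labelling_lt ht'' (fun i hi => ?_) fun i hi => ?_⟩⟩
  · rw [ha'' i hi, hb'' i hi]
  · exact ⟨hTlt _ (ha' i hi).1, (ha' i hi).2⟩
  · exact ⟨hTlt _ (hb' i hi).1, (hb' i hi).2⟩

end Completeness

theorem satisfiableOver_graphCode_iff {I : PCPData} (hI : IsPCPInstance I) :
    SatisfiableOver IsCorresponder (GraphCode.toGraph (graphCode I)) ↔ HasPCPSolution I := by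
  rw [satisfiableOver_isCorresponder_iff]
  refine ⟨?_, exists_mapsTo_of_hasPCPSolution hI⟩
  rintro ⟨p, h⟩
  obtain ⟨h, hh, -⟩ := mapsTo_graphCode_iff.1 h
  exact hasPCPSolution_of_isLabelling hh

end PCPGraph

/-- Satisfiability of graphs over the class of corresponder graphs is undecidable; moreover the Post
correspondence problem is computably many-one reducible to it. -/
theorem mainTheorem3 :
    (¬ ComputablePred fun c : RegGraph.GraphCode =>
      RegGraph.SatisfiableOver RegGraph.IsCorresponder (RegGraph.GraphCode.toGraph c)) ∧
    ∃ f : RegGraph.PCPData → RegGraph.GraphCode, Computable f ∧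
      ∀ I : RegGraph.PCPData, RegGraph.IsPCPInstance I →
        (RegGraph.SatisfiableOver RegGraph.IsCorresponder (RegGraph.GraphCode.toGraph (f I)) ↔
          RegGraph.HasPCPSolution I) := by
  refine ⟨fun hdec => ?_, PCPGraph.graphCode, PCPGraph.computable_graphCode,
    fun I hI => PCPGraph.satisfiableOver_graphCode_iff hI⟩
  obtain ⟨g, hg, hg'⟩ := PCP.exists_reduction_from_halting
  refine ComputablePred.halting_problem 0 ?_
  refine ComputablePred.computable_of_manyOneReducible (q := _)
    ⟨fun c => PCPGraph.graphCode (g c), PCPGraph.computable_graphCode.comp hg, fun c => ?_⟩ hdec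
  rw [PCPGraph.satisfiableOver_graphCode_iff (hg' c).1, (hg' c).2]
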